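/- Let $s\ge 1$, let $G=(V,E)$ be a finite undirected multigraph that is $2s$-edge-connected (any two distinct vertices are joined by $2s$ pairwise edge-disjoint paths), and let $d\in V$ be the destination. An arborescence means a $d$-rooted spanning arborescence of the directed copy of $G$, in which each edge $\{x,y\}$ yields the two arcs $(x,y)$ and $(y,x)$: every vertex other than $d$ has exactly one outgoing arc, $d$ has none, and the arcs lead from every vertex to $d$. Two arc-disjoint arborescences share an edge $\{x,y\}$ if one contains $(x,y)$ and the other contains $(y,x)$. A duplication routing function maps, at each vertex $v$, the incoming edge of a packet (or the information that the packet originates at $v$) and the set of active (non-failed) edges incident at $v$ to a set of edges at $v$; one copy of the packet is sent through each of them. Routing functions are $k$-resilient if, whenever at most $k$ edges fail, a packet originating at any vertex $v$ that is still connected to $d$ reaches $d$. The scheme Dup-Algo takes $2s$ pairwise arc-disjoint arborescences $T_1,\dots,T_{2s}$ such that $T_1,\dots,T_s$ share no edges with each other and $T_{s+1},\dots,T_{2s}$ share no edges with each other. A packet $p$ is first routed along $T_1$, and it is routed along the same arborescence towards $d$ unless it hits a failed edge. If $p$ hits a failed arc $(x,y)$ along $T_i$, then: * if $i<s$, one copy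 of $p$ is created; the original is forwarded along $T_{i+1}$ and the copy along the arborescence that contains the opposite arc $(y,x)$ of the same edge (the copy is discarded if there is no such arborescence); * if $i=s$, $s-1$ copies of $p$ are created; the original is forwarded along $T_{s+1}$ and the $j$-th copy along $T_{s+j+1}$, $1\le j\le s-1$; * if $i>s$, $p$ is destroyed. **Theorem.** Arborescences $T_1,\dots,T_{2s}$ as above exist. For every such choice, Dup-Algo yields $(2s-1)$-resilient duplication routing functions. Moreover, for every set of failed edges and every origin of the packet, the scheme terminates with a uniquely determined number of copies and of deliveries, and at least one of the packets is delivered to $d$ if at most $2s-1$ edges fail. If $f$ is the number of failed edges, then the number of copies created, not counting the original packet, is at most $f$ if $f<s$, and at most $2s-2$ otherwise (that is, at most $2s-1$ packets in total including the original). These bounds are the exact worst case: if $|V|\ge 2$, then for every $f\le |E|$ they are attained for some set of $f$ failed edges and some origin. -/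

import Mathlib

open scoped Graph

namespace FailoverRouting

universe u w

variable {α : Type u} {β : Type w}

/-- An arc `(tail, head)` carried by the link `edge` of a multigraph (so parallel links carry
different arcs). -/
@[ext]
structure Arc (α : Type u) (β : Type w) where
  edge : β
  tail : α
  head : α

/-- The opposite arc, carried by the same link. -/
def Arc.reverse (a : Arc α β) : Arc α β := ⟨a.edge, a.head, a.tail⟩

/-- The arcs of the directed copy of `G`: every edge `{x, y}` yields `(x, y)` and `(y, x)`. -/
def directedCopy (G : Graph α β) : Set (Arc α β) := {a | G.IsLink a.edge a.tail a.head}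

/-- `IsWalk A x y p`: the list of arcs `p` is a directed walk from `x` to `y` using arcs of `A`. -/
inductive IsWalk (A : Set (Arc α β)) : α → α → List (Arc α β) → Prop
  | nil (x : α) : IsWalk A x x []
  | cons {a : Arc α β} {y : α} {p : List (Arc α β)} :
      a ∈ A → IsWalk A a.head y p → IsWalk A a.tail y (a :: p)

/-- A directed path: a directed walk that repeats no vertex. -/
def IsPath (A : Set (Arc α β)) (x y : α) (p : List (Arc α β)) : Prop :=
  IsWalk A x y p ∧ (x :: p.map Arc.head).Nodup

/-- `G` is `k`-edge-connected: any two distinct vertices are joined by `k` pairwise edge-disjoint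
paths. -/
def IsEdgeConnected (G : Graph α β) (k : ℕ) : Prop :=
  ∀ x ∈ V(G), ∀ y ∈ V(G), x ≠ y → ∃ p : Fin k → List (Arc α β),
    (∀ i, IsPath (directedCopy G) x y (p i)) ∧
    ∀ i j, i ≠ j → ∀ a ∈ p i, ∀ b ∈ p j, a.edge ≠ b.edge

/-- `T` is (the arc set of) a `d`-rooted spanning arborescence of the directed copy of `G`: the root
has no outgoing arc, every other vertex has exactly one, and following the arcs leads from every
vertex to the root. -/
structure IsArborescence (G : Graph α β) (d : α) (T : Set (Arc α β)) : Prop where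
  subset : T ⊆ directedCopy G
  root : ∀ a ∈ T, a.tail ≠ d
  existsUnique_out : ∀ v ∈ V(G), v ≠ d → ∃! a, a ∈ T ∧ a.tail = v
  exists_path : ∀ v ∈ V(G), ∃ p, IsPath T v d p

/-- `T₁` and `T₂` do not share an edge: no edge is used by `T₁` in one direction and by `T₂` in the
opposite direction (this is used for arc-disjoint `T₁`, `T₂`). -/
def NotShare (T₁ T₂ : Set (Arc α β)) : Prop := ∀ a ∈ T₁, a.reverse ∉ T₂

/-- The arborescences `T 1, …, T (2 * s)` that the duplication scheme works with (other values of
`T` are irrelevant): `d`-rooted spanning arborescences, pairwise arc-disjoint, such that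
the first `s` do not share edges with each other, and neither do the last `s`. -/
structure IsDupFamily (G : Graph α β) (d : α) (s : ℕ) (T : ℕ → Set (Arc α β)) : Prop where
  arborescence : ∀ i ∈ Finset.Icc 1 (2 * s), IsArborescence G d (T i)
  arcDisjoint : ∀ i ∈ Finset.Icc 1 (2 * s), ∀ j ∈ Finset.Icc 1 (2 * s), i ≠ j →
    Disjoint (T i) (T j)
  notShare_first : ∀ i ∈ Finset.Icc 1 s, ∀ j ∈ Finset.Icc 1 s, i ≠ j → NotShare (T i) (T j)
  notShare_last : ∀ i ∈ Finset.Icc (s + 1) (2 * s), ∀ j ∈ Finset.Icc (s + 1) (2 * s), i ≠ j →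
    NotShare (T i) (T j)

/-! ### Routing with packet duplication -/

/-- A duplication routing function: at each vertex, it maps the incoming edge of a packet (`none` if
the packet originates at the vertex) and the set of active edges incident at the vertex to the set
of edges through which one copy each is sent. -/
abbrev DuplicationRouting (α : Type u) (β : Type w) : Type (max u w) :=
  α → Option β → Set β → Set β

/-- The active (non-failed) edges incident at `v`, where `F` is the set of failed edges. -/
def activeEdges (G : Graph α β) (F : Finset β) (v : α) : Set β := G.incidenceSet v \ (F : Set β)

/-- `Visits G F d R o v inc`: when the edges of `F` have failed and a packet with destination `d`
that originates at `o` is routed according to `R`, the packet or a copy of it arrives at `v` through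
the edge `inc`. Packets are not forwarded any more once they have reached `d`. -/
inductive Visits (G : Graph α β) (F : Finset β) (d : α) (R : DuplicationRouting α β) (o : α) :
    α → Option β → Prop
  | origin : Visits G F d R o o none
  | hop {v v' : α} {inc : Option β} {e : β} :
      Visits G F d R o v inc → v ≠ d → e ∈ R v inc (activeEdges G F v) → e ∉ F →
      G.IsLink e v v' → Visits G F d R o v' (some e)

/-- `R` is `k`-resilient: whenever at most `k` edges fail, a packet originating at any vertex `v`
that is still connected to `d` reaches `d`. -/
def IsResilient (G : Graph α β) (d : α) (R : DuplicationRouting α β) (k : ℕ) : Prop :=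
  ∀ F : Finset β, (F : Set β) ⊆ E(G) → F.card ≤ k → ∀ v ∈ V(G),
    Relation.ReflTransGen (G.deleteEdges (F : Set β)).Adj v d → ∃ inc, Visits G F d R v d inc

/-! ### The duplication scheme -/

open scoped Classical in
/-- The indices of the arborescences along which the packet and its copies continue when a packet
routed along `T i` hits the failed arc `a` of `T i`. If `i < s`, the packet continues along
`T (i + 1)` and one copy along the arborescence that contains the opposite arc of `a` (if there is
none, the copy cannot be forwarded and is discarded). If `i = s`, the packet and `s - 1` copies
continue along `T (s + 1), …, T (2 * s)`. If `s < i`, the packet is destroyed. -/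
noncomputable def dupNext (s : ℕ) (T : ℕ → Set (Arc α β)) (i : ℕ) (a : Arc α β) : Finset ℕ :=
  if i < s then insert (i + 1) ((Finset.Icc 1 (2 * s)).filter fun l => a.reverse ∈ T l)
  else if i = s then Finset.Icc (s + 1) (2 * s)
  else ∅

/-- The number of copies created when a packet routed along `T i` hits a failed edge. -/
def dupCreated (s i : ℕ) : ℕ := if i < s then 1 else if i = s then s - 1 else 0

/-- `DupReroutes s T v act i j`: when `act` is the set of active edges at `v`, a packet that is at
`v` and routed along `T i` is, after some number (possibly zero) of failed edges hit at `v`, itself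
or in a copy routed along `T j` at `v`. -/
inductive DupReroutes (s : ℕ) (T : ℕ → Set (Arc α β)) (v : α) (act : Set β) (i : ℕ) : ℕ → Prop
  | refl : DupReroutes s T v act i i
  | step {j l : ℕ} {a : Arc α β} :
      DupReroutes s T v act i j → a ∈ T j → a.tail = v → a.edge ∉ act → l ∈ dupNext s T j a →
      DupReroutes s T v act i l

/-- The arborescence along which a packet at `v` is being routed, recovered from its incoming edge:
the one containing the arc by which the packet arrived, and `T 1` if it originates at `v`. -/
def dupCurrent (s : ℕ) (T : ℕ → Set (Arc α β)) (v : α) : Option β → Set ℕ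
  | none => {1}
  | some e => {i | i ∈ Finset.Icc 1 (2 * s) ∧ ∃ a ∈ T i, a.edge = e ∧ a.head = v}

/-- The routing functions computed by the duplication scheme from `T 1, …, T (2 * s)`. -/
def dupRouting (s : ℕ) (T : ℕ → Set (Arc α β)) : DuplicationRouting α β :=
  fun v inc act => {e | e ∈ act ∧ ∃ i ∈ dupCurrent s T v inc, ∃ j, DupReroutes s T v act i j ∧
    ∃ a ∈ T j, a.tail = v ∧ a.edge = e}

/-- `DupRun d s T F v i c n`: when the edges of `F` have failed, routing a packet that is at `v` and
routed along `T i` by the duplication scheme comes to an end, with a total of `c` copies created on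
the way (by the packet and all its descendants, not counting the packet itself), and with `n` of
these packets delivered to `d`. -/
inductive DupRun (d : α) (s : ℕ) (T : ℕ → Set (Arc α β)) (F : Finset β) : α → ℕ → ℕ → ℕ → Prop
  | deliver (i : ℕ) : DupRun d s T F d i 0 1
  | forward {i c n : ℕ} {a : Arc α β} :
      a.tail ≠ d → a ∈ T i → a.edge ∉ F → DupRun d s T F a.head i c n →
      DupRun d s T F a.tail i c n
  | reroute {i : ℕ} {a : Arc α β} (c n : ℕ → ℕ) :
      a.tail ≠ d → a ∈ T i → a.edge ∈ F →
      (∀ j ∈ dupNext s T i a, DupRun d s T F a.tail j (c j) (n j)) →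
      DupRun d s T F a.tail i (dupCreated s i + ∑ j ∈ dupNext s T i a, c j)
        (∑ j ∈ dupNext s T i a, n j)

/-- The maximal number of copies of a packet: `f` if `f < s`, and otherwise `2 * s - 1` packets
including the original one, that is, `2 * s - 1 - 1` copies. -/
def dupBound (s f : ℕ) : ℕ := if f < s then f else 2 * s - 1 - 1

end FailoverRouting

/-! Existence. A `2 * s`-edge-connected graph has an orientation in which every cut is left by at
least `s` arcs (Nash-Williams, `exists_orientation`, through Mader's degree lemma and Lovász's
splitting-off). Every cut is then also entered by `s` arcs, so Edmonds' theorem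
(`exists_disjoint_inTrees`) gives `s` arc-disjoint arborescences in the orientation and `s` more in
its reversal. Each half uses every edge in one direction only, hence shares no edges.

Resilience. If nothing is delivered, the packet has hit failed arcs `a 1, …, a s` on the first `s`
arborescences, and these lie on `s` different edges. For `l > s`, the packet or copy sent along `T
l` from the tail of `a s` fails as well. If a failed arc of `T l` lies on the edge of some `a j`, it
is the reverse of `a j`; the copy bounced off `a j` then started at the head of that arc, and it too
hit a failed arc further on. So the last failed arc on the path in `T l` lies on a new edge, and `2
* s` edges have failed in all (`IsDupFamily.two_mul_le_card`).

Copies. Copies on the last `s` arborescences create no further ones. Delivery along `T i` with `i ≤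
s` therefore costs `i - 1` copies, paid for by `i - 1` different failed edges; otherwise `s - 1`
bounced copies and `s - 1` copies from `T s` arise. Failing the arcs that leave one vertex in the
first arborescences attains the bounds. -/

namespace FailoverRouting

/-! ### Cut functions, uncrossing and Mader's degree lemma -/

section Cuts

variable {α β : Type*}

/-- `(t', h')` arises from `(t, h)` by reversing some arcs. -/
def IsReorientation (t h t' h' : β → α) : Prop :=
  ∀ e, (t' e = t e ∧ h' e = h e) ∨ (t' e = h e ∧ h' e = t e)

theorem IsReorientation.trans {t h t' h' t'' h'' : β → α} (h₁ : IsReorientation t h t' h')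
    (h₂ : IsReorientation t' h' t'' h'') : IsReorientation t h t'' h'' := by
  intro e
  rcases h₁ e with ⟨a, b⟩ | ⟨a, b⟩ <;> rcases h₂ e with ⟨c, d⟩ | ⟨c, d⟩ <;> simp [a, b, c, d]

variable [DecidableEq α]

/-- The number of arcs of the digraph `(E, t, h)` (with tails `t` and heads `h`) that leave `X`. -/
def outDeg (t h : β → α) (E : Finset β) (X : Finset α) : ℕ :=
  (E.filter fun e => t e ∈ X ∧ h e ∉ X).card

/-- The number of edges with exactly one end in `X`. -/
def cutDeg (t h : β → α) (E : Finset β) (X : Finset α) : ℕ :=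
  (E.filter fun e => ¬(t e ∈ X ↔ h e ∈ X)).card

theorem IsReorientation.cutDeg_eq {t h t' h' : β → α} (hr : IsReorientation t h t' h')
    (E : Finset β) (X : Finset α) : cutDeg t' h' E X = cutDeg t h E X := by
  unfold cutDeg
  congr 1
  refine Finset.filter_congr fun e _ => ?_
  rcases hr e with ⟨a, b⟩ | ⟨a, b⟩ <;> rw [a, b]
  tauto

theorem outDeg_congr {t h t' h' : β → α} {E : Finset β} {X : Finset α}
    (ht : ∀ e ∈ E, t e = t' e) (hh : ∀ e ∈ E, h e = h' e) :
    outDeg t h E X = outDeg t' h' E X := by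
  unfold outDeg
  congr 1
  exact Finset.filter_congr fun e he => by rw [ht e he, hh e he]

theorem outDeg_mono {t h : β → α} {E E' : Finset β} (hE : E ⊆ E') (X : Finset α) :
    outDeg t h E X ≤ outDeg t h E' X :=
  Finset.card_le_card (Finset.filter_subset_filter _ hE)

theorem outDeg_insert [DecidableEq β] {t h : β → α} {E : Finset β} {e : β} (he : e ∉ E)
    (X : Finset α) :
    outDeg t h (insert e E) X = (if t e ∈ X ∧ h e ∉ X then 1 else 0) + outDeg t h E X := by
  unfold outDeg
  rw [Finset.filter_insert]
  split_ifs with hc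
  · rw [Finset.card_insert_of_notMem (by simp [he]), add_comm]
  · simp

theorem cutDeg_insert [DecidableEq β] {t h : β → α} {E : Finset β} {e : β} (he : e ∉ E)
    (X : Finset α) :
    cutDeg t h (insert e E) X = (if ¬(t e ∈ X ↔ h e ∈ X) then 1 else 0) + cutDeg t h E X := by
  unfold cutDeg
  rw [Finset.filter_insert]
  by_cases hc : t e ∈ X ↔ h e ∈ X
  · simp [hc]
  · rw [if_pos hc, if_pos hc, Finset.card_insert_of_notMem (by simp [he]), add_comm]

theorem cutDeg_congr {t h t' h' : β → α} {E : Finset β} {X : Finset α}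
    (ht : ∀ e ∈ E, t e = t' e) (hh : ∀ e ∈ E, h e = h' e) :
    cutDeg t h E X = cutDeg t' h' E X := by
  unfold cutDeg
  congr 1
  exact Finset.filter_congr fun e he => by rw [ht e he, hh e he]

theorem outDeg_submodular (t h : β → α) (E : Finset β) (X Y : Finset α) :
    outDeg t h E (X ∩ Y) + outDeg t h E (X ∪ Y) ≤ outDeg t h E X + outDeg t h E Y := by
  simp only [outDeg, Finset.card_filter, ← Finset.sum_add_distrib]
  refine Finset.sum_le_sum fun e _ => ?_
  by_cases a : t e ∈ X <;> by_cases b : t e ∈ Y <;> by_cases c : h e ∈ X <;>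
    by_cases d : h e ∈ Y <;> simp [a, b, c, d]

theorem cutDeg_submodular (t h : β → α) (E : Finset β) (X Y : Finset α) :
    cutDeg t h E (X ∩ Y) + cutDeg t h E (X ∪ Y) ≤ cutDeg t h E X + cutDeg t h E Y := by
  simp only [cutDeg, Finset.card_filter, ← Finset.sum_add_distrib]
  refine Finset.sum_le_sum fun e _ => ?_
  by_cases a : t e ∈ X <;> by_cases b : t e ∈ Y <;> by_cases c : h e ∈ X <;>
    by_cases d : h e ∈ Y <;> simp [a, b, c, d]

/-- The inequality holds edge by edge. An edge from outside all three sets to their common part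
counts three times on the right but only once among the four cuts on the left, which leaves room for
the extra term. Only one direction is counted, as edges at the split vertex will point away from it.
-/
theorem cutDeg_three_sets (t h : β → α) (E : Finset β) (X Y W : Finset α) :
    cutDeg t h E (X ∩ Y ∩ W) + cutDeg t h E (X \ (Y ∪ W)) + cutDeg t h E (Y \ (X ∪ W)) +
      cutDeg t h E (W \ (X ∪ Y)) +
      2 * (E.filter fun e => t e ∉ X ∪ Y ∪ W ∧ h e ∈ X ∩ Y ∩ W).card ≤
      cutDeg t h E X + cutDeg t h E Y + cutDeg t h E W := by
  simp only [cutDeg, Finset.card_filter, ← Finset.sum_add_distrib, Finset.mul_sum]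
  refine Finset.sum_le_sum fun e _ => ?_
  by_cases a : t e ∈ X <;> by_cases b : t e ∈ Y <;> by_cases c : t e ∈ W <;>
    by_cases a' : h e ∈ X <;> by_cases b' : h e ∈ Y <;> by_cases c' : h e ∈ W <;>
    simp [a, b, c, a', b', c']

theorem cutDeg_sdiff {t h : β → α} {E : Finset β} {V : Finset α}
    (hV : ∀ e ∈ E, t e ∈ V ∧ h e ∈ V) (X : Finset α) :
    cutDeg t h E (V \ X) = cutDeg t h E X := by
  unfold cutDeg
  congr 1
  refine Finset.filter_congr fun e he => ?_
  simp only [Finset.mem_sdiff, hV e he, true_and]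
  tauto

theorem outDeg_sdiff {t h : β → α} {E : Finset β} {V : Finset α}
    (hV : ∀ e ∈ E, t e ∈ V ∧ h e ∈ V) (X : Finset α) :
    outDeg t h E (V \ X) = outDeg h t E X := by
  unfold outDeg
  congr 1
  refine Finset.filter_congr fun e he => ?_
  simp only [Finset.mem_sdiff, hV e he, true_and]
  tauto

theorem outDeg_inter {t h : β → α} {E : Finset β} {V : Finset α}
    (hV : ∀ e ∈ E, t e ∈ V ∧ h e ∈ V) (X : Finset α) :
    outDeg t h E (X ∩ V) = outDeg t h E X := by
  unfold outDeg
  congr 1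
  refine Finset.filter_congr fun e he => ?_
  simp [hV e he]

/-- All edge cuts of the graph `(V, E)` have at least `K` edges. -/
def CutsGe (t h : β → α) (V : Finset α) (E : Finset β) (K : ℕ) : Prop :=
  ∀ X ⊆ V, X.Nonempty → X ≠ V → K ≤ cutDeg t h E X

/-- Mader: if no edge can be deleted, then some vertex has degree `K`. -/
theorem exists_cutDeg_singleton_eq {t h : β → α} {V : Finset α} {E : Finset β} {K : ℕ}
    (hK : 1 ≤ K) (hV : ∀ e ∈ E, t e ∈ V ∧ h e ∈ V) (hc : CutsGe t h V E K)
    (hnt : 1 < V.card)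
    (hmin : ∀ e ∈ E, ∃ X ⊆ V, X.Nonempty ∧ X ≠ V ∧ ¬(t e ∈ X ↔ h e ∈ X) ∧ cutDeg t h E X = K) :
    ∃ z ∈ V, cutDeg t h E {z} = K := by
  classical
  have hEne : E.Nonempty := by
    obtain ⟨a, ha⟩ := Finset.card_pos.1 (by omega : 0 < V.card)
    have := hc {a} (by simpa using ha) (by simp) (by rintro rfl; simp at hnt)
    obtain ⟨e, he⟩ := Finset.card_pos.1 (lt_of_lt_of_le hK this)
    exact ⟨e, (Finset.mem_filter.1 he).1⟩
  set S := V.powerset.filter fun X => X.Nonempty ∧ X ≠ V ∧ cutDeg t h E X = K with hS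
  have hSne : S.Nonempty := by
    obtain ⟨e, he⟩ := hEne
    obtain ⟨X, h1, h2, h3, -, h4⟩ := hmin e he
    exact ⟨X, by simp [hS, h1, h2, h3, h4]⟩
  obtain ⟨X, hX, hXmin⟩ := Finset.exists_min_image S Finset.card hSne
  simp only [hS, Finset.mem_filter, Finset.mem_powerset] at hX hXmin
  obtain ⟨hXV, ⟨v, hv⟩, hXne, hXK⟩ := hX
  -- `X` is a smallest tight set, that is, one with exactly `K` edges in its cut; the aim is that it
  -- is a single vertex.
  have key : ∀ Y ⊆ V, Y.Nonempty → Y ≠ V → cutDeg t h E Y ≤ K → ¬ Y ⊂ X := by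
    intro Y h1 h2 h3 h4 h5
    have := hXmin Y ⟨h1, h2, h3, le_antisymm h4 (hc Y h1 h2 h3)⟩
    have := Finset.card_lt_card h5
    omega
  by_cases hX1 : X = {v}
  · exact ⟨v, hXV hv, hX1 ▸ hXK⟩
  exfalso
  have hsing : ({v} : Finset α) ≠ V := by rintro rfl; simp at hnt
  by_cases hin : ∃ e ∈ E, t e ∈ X ∧ h e ∈ X
  · obtain ⟨e, he, hte, hhe⟩ := hin
    obtain ⟨Y, hYV, hYne, hYV', hcr, hYK⟩ := hmin e he
    -- An edge inside `X` crosses a tight set `Y`. Uncrossing gives a smaller tight set inside `X`: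
    -- the complement of `Y` if the union is everything, and `X ∩ Y` by submodularity otherwise.
    by_cases hu : X ∪ Y = V
    · refine key (V \ Y) Finset.sdiff_subset ?_ ?_ ?_ ?_
      · exact Finset.sdiff_nonempty.2 fun hh => hYV' (hYV.antisymm hh)
      · intro hh
        obtain ⟨y, hy⟩ := hYne
        have := hYV hy
        rw [← hh] at this
        simp [hy] at this
      · rw [cutDeg_sdiff hV, hYK]
      · refine (Finset.ssubset_iff_of_subset ?_).2 ?_
        · intro x hx
          rw [Finset.mem_sdiff, ← hu, Finset.mem_union] at hx
          tauto
        · by_cases h1 : t e ∈ Y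
          · exact ⟨t e, hte, by simp [h1]⟩
          · exact ⟨h e, hhe, by simp; tauto⟩
    · have hsub := cutDeg_submodular t h E X Y
      have hint : (X ∩ Y).Nonempty := by
        by_cases h1 : t e ∈ Y
        · exact ⟨t e, by simp [h1, hte]⟩
        · exact ⟨h e, by simp [hhe]; tauto⟩
      have hlt : X ∩ Y ⊂ X := by
        refine (Finset.ssubset_iff_of_subset Finset.inter_subset_left).2 ?_
        by_cases h1 : t e ∈ Y
        · exact ⟨h e, hhe, by simp; tauto⟩
        · exact ⟨t e, hte, by simp [h1]⟩
      have h2 := hc (X ∪ Y) (Finset.union_subset hXV hYV) ⟨v, by simp [hv]⟩ hu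
      refine key _ (Finset.inter_subset_left.trans hXV) hint ?_ (by omega) hlt
      intro hh
      exact hlt.2 (hh ▸ hXV)
  -- With no edge inside `X`, the cut of `X` splits into those of `{v}` and `X.erase v`, so it has
  -- at least `2 * K > K` edges.
  · push Not at hin
    have h1 := hc {v} (by simpa using hXV hv) (by simp) hsing
    have h2 := hc (X.erase v) ((Finset.erase_subset _ _).trans hXV) (by
      rw [Finset.nonempty_iff_ne_empty]
      intro hh
      rcases (Finset.erase_eq_empty_iff X v).1 hh with h0 | h0
      · simp [h0] at hv
      · exact hX1 h0) (by
      intro hh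
      have : v ∈ X.erase v := hh ▸ hXV hv
      simp at this)
    have h3 : cutDeg t h E (X.erase v) + cutDeg t h E {v} ≤ cutDeg t h E X := by
      simp only [cutDeg, Finset.card_filter, ← Finset.sum_add_distrib]
      refine Finset.sum_le_sum fun e he => ?_
      have := hin e he
      by_cases a : t e ∈ X <;> by_cases b : h e ∈ X <;> by_cases c : t e = v <;>
        by_cases d : h e = v <;> simp_all
    omega

end Cuts

/-! ### Splitting off and orientations -/

section Splitting

variable {α β : Type*} [DecidableEq α] [DecidableEq β]

/-- Lovász: edges `e₁ = {z, x}` and `e₂ = {z, y}` can be split off at a vertex `z` of even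
degree. Here all edges at `z` are directed away from `z`. -/
theorem exists_splittable {t h : β → α} {V : Finset α} {E : Finset β} {K : ℕ} {z : α} {e₁ : β}
    (hK : 2 ≤ K) (hz : z ∉ V) (hV : ∀ e ∈ E, t e ∈ insert z V ∧ h e ∈ V)
    (hc : CutsGe t h V E K) (heven : Even (E.filter fun e => t e = z).card)
    (he₁ : e₁ ∈ E) (hte₁ : t e₁ = z) :
    ∃ e₂ ∈ E, e₂ ≠ e₁ ∧ t e₂ = z ∧
      ∀ X ⊆ V, X ≠ V → h e₁ ∈ X → h e₂ ∈ X → K + 2 ≤ cutDeg t h E X := by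
  classical
  by_contra hcon
  push Not at hcon
  set Z := E.filter fun e => t e = z with hZ
  have he₁Z : e₁ ∈ Z := by simp [hZ, he₁, hte₁]
  -- The dangerous sets: those whose cut would become too small if `e₁` were split off with another
  -- edge ending in the set.
  let D : Finset α → Prop := fun X => X ⊆ V ∧ X ≠ V ∧ h e₁ ∈ X ∧ cutDeg t h E X ≤ K + 1
  have hD : ∀ e ∈ Z, ∃ X, D X ∧ h e ∈ X := by
    have h1 : ∀ e ∈ Z, e ≠ e₁ → ∃ X, D X ∧ h e ∈ X := by
      intro e he hne
      simp only [hZ, Finset.mem_filter] at he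
      obtain ⟨X, a, b, c, d, f⟩ := hcon e he.1 hne he.2
      exact ⟨X, ⟨a, b, c, by omega⟩, d⟩
    intro e he
    by_cases hne : e = e₁
    · subst hne
      have h2 : 1 < Z.card := by
        have : 0 < Z.card := Finset.card_pos.2 ⟨_, he⟩
        obtain ⟨r, hr⟩ := heven
        omega
      obtain ⟨e', he', hne'⟩ := Finset.exists_mem_ne h2 e
      obtain ⟨X, hX, -⟩ := h1 e' he' hne'
      exact ⟨X, hX, hX.2.2.1⟩
    · exact h1 e he hne
  -- Comparing the cuts of `X` and `V \ X` gives the bound `Z.card + 1`; evenness of the degree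
  -- removes the `1`.
  have hhalf : ∀ X, D X → 2 * (Z.filter fun e => h e ∈ X).card ≤ Z.card := by
    rintro X ⟨hXV, hXne, hxX, hXK⟩
    have h1 := hc (V \ X) Finset.sdiff_subset
      (Finset.sdiff_nonempty.2 fun hh => hXne (hXV.antisymm hh)) (by
        intro hh
        have := hXV hxX
        rw [← hh] at this
        simp [hxX] at this)
    have h2 : cutDeg t h E (V \ X) + 2 * (Z.filter fun e => h e ∈ X).card
        = cutDeg t h E X + Z.card := by
      simp only [cutDeg, hZ, Finset.filter_filter, Finset.card_filter, Finset.mul_sum,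
        ← Finset.sum_add_distrib]
      refine Finset.sum_congr rfl fun e he => ?_
      obtain ⟨h3, h4⟩ := hV e he
      have h5 : z ∉ X := fun hh => hz (hXV hh)
      by_cases a : t e = z
      · by_cases b : h e ∈ X <;> simp [a, h4, h5, b, hz]
      · have h6 : t e ∈ V := by simpa [a] using h3
        by_cases b : h e ∈ X <;> by_cases c : t e ∈ X <;> simp [a, b, c, h4, h6]
    obtain ⟨r, hr⟩ := heven
    omega
  let P : Finset (Finset α) → Prop := fun 𝓕 => (∀ X ∈ 𝓕, D X) ∧ ∀ e ∈ Z, ∃ X ∈ 𝓕, h e ∈ X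
  have hP : ∃ n, ∃ 𝓕, P 𝓕 ∧ 𝓕.card = n := by
    choose! f hf using hD
    refine ⟨_, Z.image f, ⟨?_, ?_⟩, rfl⟩
    · intro X hX
      obtain ⟨e, he, rfl⟩ := Finset.mem_image.1 hX
      exact (hf e he).1
    · intro e he
      exact ⟨f e, Finset.mem_image_of_mem _ he, (hf e he).2⟩
  obtain ⟨𝓕, ⟨h𝓕D, h𝓕c⟩, hcard⟩ := Nat.find_spec hP
  have hmin : ∀ 𝓕', P 𝓕' → 𝓕.card ≤ 𝓕'.card := fun 𝓕' h' =>
    hcard ▸ Nat.find_min' hP ⟨𝓕', h', rfl⟩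
  -- In a smallest cover of the neighbours of `z` by dangerous sets, a member without a private
  -- vertex could be dropped.
  have hpriv : ∀ X ∈ 𝓕, ∃ x ∈ X, ∀ Y ∈ 𝓕, Y ≠ X → x ∉ Y := by
    intro X hX
    by_contra hno
    push Not at hno
    have := hmin (𝓕.erase X) ⟨fun Y hY => h𝓕D Y (Finset.mem_of_mem_erase hY), by
      intro e he
      obtain ⟨Y, hY, heY⟩ := h𝓕c e he
      by_cases hYX : Y = X
      · subst hYX
        obtain ⟨W, hW, hne, hW'⟩ := hno _ heY
        exact ⟨W, Finset.mem_erase.2 ⟨hne, hW⟩, hW'⟩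
      · exact ⟨Y, Finset.mem_erase.2 ⟨hYX, hY⟩, heY⟩⟩
    have := Finset.card_erase_lt_of_mem hX
    omega
  -- Each set takes at most half of the edges at `z`, and both take `e₁`, so two never suffice and
  -- the cover has at least three members.
  have h2cov : ∀ X Y, D X → D Y → ∃ e ∈ Z, h e ∉ X ∧ h e ∉ Y := by
    intro X Y hX hY
    by_contra hno
    push Not at hno
    have h1 := hhalf X hX
    have h2 := hhalf Y hY
    have h3 := Finset.card_union_add_card_inter (Z.filter fun e => h e ∈ X)
      (Z.filter fun e => h e ∈ Y)
    have h4 : Z ⊆ (Z.filter fun e => h e ∈ X) ∪ (Z.filter fun e => h e ∈ Y) := by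
      intro e he
      have := hno e he
      simp only [Finset.mem_union, Finset.mem_filter, he, true_and]
      tauto
    have h5 := Finset.card_le_card h4
    have h6 : 0 < ((Z.filter fun e => h e ∈ X) ∩ (Z.filter fun e => h e ∈ Y)).card :=
      Finset.card_pos.2 ⟨e₁, by simp [he₁Z, hX.2.2.1, hY.2.2.1]⟩
    omega
  have h3card : 2 < 𝓕.card := by
    obtain ⟨X, hX, -⟩ := h𝓕c e₁ he₁Z
    obtain ⟨e, he, heX, -⟩ := h2cov X X (h𝓕D X hX) (h𝓕D X hX)
    obtain ⟨Y, hY, heY⟩ := h𝓕c e he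
    obtain ⟨e', he', heX', heY'⟩ := h2cov X Y (h𝓕D X hX) (h𝓕D Y hY)
    obtain ⟨W, hW, heW⟩ := h𝓕c e' he'
    refine Finset.two_lt_card.2 ⟨X, hX, Y, hY, W, hW, ?_, ?_, ?_⟩
    · rintro rfl; exact heX heY
    · rintro rfl; exact heX' heW
    · rintro rfl; exact heY' heW
  obtain ⟨X, hX, Y, hY, W, hW, hXY, hXW, hYW⟩ := Finset.two_lt_card.1 h3card
  -- The four cuts on the left have at least `K` edges and `e₁` contributes to the extra term, so `4
  -- * K + 2 ≤ 3 * (K + 1)`, which contradicts `2 ≤ K`.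
  have hthree := cutDeg_three_sets t h E X Y W
  have hle : ∀ A ∈ 𝓕, ∀ B ⊆ A, B.Nonempty → K ≤ cutDeg t h E B := by
    intro A hA B hB hne
    obtain ⟨a, b, -⟩ := h𝓕D A hA
    refine hc B (hB.trans a) hne ?_
    rintro rfl
    exact b (a.antisymm hB)
  have hpriv' : ∀ A ∈ 𝓕, ∀ B ∈ 𝓕, ∀ C ∈ 𝓕, B ≠ A → C ≠ A → K ≤ cutDeg t h E (A \ (B ∪ C)) := by
    intro A hA B hB C hC hBA hCA
    obtain ⟨x, hx, hx'⟩ := hpriv A hA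
    exact hle A hA _ Finset.sdiff_subset ⟨x, by simp [hx, hx' B hB hBA, hx' C hC hCA]⟩
  have a1 := hpriv' X hX Y hY W hW hXY.symm hXW.symm
  have a2 := hpriv' Y hY X hX W hW hXY hYW.symm
  have a3 := hpriv' W hW X hX Y hY hXW hYW
  obtain ⟨x1, x2, x3, x4⟩ := h𝓕D X hX
  obtain ⟨y1, y2, y3, y4⟩ := h𝓕D Y hY
  obtain ⟨w1, w2, w3, w4⟩ := h𝓕D W hW
  have a4 := hle X hX (X ∩ Y ∩ W) (Finset.inter_subset_left.trans Finset.inter_subset_left)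
    ⟨h e₁, by simp [x3, y3, w3]⟩
  have a5 : 0 < (E.filter fun e => t e ∉ X ∪ Y ∪ W ∧ h e ∈ X ∩ Y ∩ W).card := by
    refine Finset.card_pos.2 ⟨e₁, ?_⟩
    simp only [Finset.mem_filter, he₁, hte₁, Finset.mem_union, Finset.mem_inter, x3, y3, w3,
      true_and, and_self, and_true]
    rintro ((hh | hh) | hh)
    exacts [hz (x1 hh), hz (y1 hh), hz (w1 hh)]
  omega

/-- If every `2 * k`-edge-connected graph on `V` has an orientation in which each cut is left by at
least `k` arcs, then so has every graph with an additional vertex `z` of even degree, where only the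
cuts that separate vertices of `V` count, and this orientation can be chosen balanced at `z`. -/
theorem exists_orientation_of_splitOff {V : Finset α} {k : ℕ} {z : α} (hk : 1 ≤ k) (hz : z ∉ V)
    (ih : ∀ (E : Finset β) (t h : β → α), (∀ e ∈ E, t e ∈ V ∧ h e ∈ V) →
      CutsGe t h V E (2 * k) → ∃ t' h', IsReorientation t h t' h' ∧
        ∀ X ⊆ V, X.Nonempty → X ≠ V → k ≤ outDeg t' h' E X)
    (n : ℕ) : ∀ (E : Finset β) (t h : β → α), (∀ e ∈ E, t e ∈ insert z V ∧ h e ∈ V) →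
      (E.filter fun e => t e = z).card = 2 * n → CutsGe t h V E (2 * k) →
      ∃ t' h', IsReorientation t h t' h' ∧
        (∀ X, (X ∩ V).Nonempty → ¬ V ⊆ X → k ≤ outDeg t' h' E X) ∧
        outDeg t' h' E {z} = n ∧ outDeg h' t' E {z} = n := by
  induction n with
  | zero =>
    intro E t h hV hZ hc
    have hV' : ∀ e ∈ E, t e ∈ V ∧ h e ∈ V := by
      intro e he
      obtain ⟨h1, h2⟩ := hV e he
      refine ⟨(Finset.mem_insert.1 h1).resolve_left fun hh => ?_, h2⟩
      have := Finset.filter_eq_empty_iff.1 (Finset.card_eq_zero.1 hZ)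
      exact this he hh
    obtain ⟨t', h', hr, ho⟩ := ih E t h hV' hc
    have hV'' : ∀ e ∈ E, t' e ∈ V ∧ h' e ∈ V := by
      intro e he
      have := hV' e he
      rcases hr e with ⟨a, b⟩ | ⟨a, b⟩ <;> rw [a, b] <;> tauto
    refine ⟨t', h', hr, ?_, ?_, ?_⟩
    · intro X hne hnV
      rw [← outDeg_inter hV'']
      refine ho _ Finset.inter_subset_right hne fun hh => hnV ?_
      rw [← hh]
      exact Finset.inter_subset_left
    all_goals
      refine Finset.card_eq_zero.2 (Finset.filter_eq_empty_iff.2 fun e he => ?_)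
      have := hV'' e he
      simp only [Finset.mem_singleton]
      rintro ⟨a, b⟩
      rw [a] at this
      tauto
  | succ n ihn =>
    intro E t h hV hZ hc
    obtain ⟨e₁, he₁Z⟩ := Finset.card_pos.1 (by omega : 0 < (E.filter fun e => t e = z).card)
    obtain ⟨he₁, hte₁⟩ := Finset.mem_filter.1 he₁Z
    obtain ⟨e₂, he₂, hne, hte₂, hsplit⟩ := exists_splittable (by omega) hz hV hc
      (by rw [hZ]; simp) he₁ hte₁
    set R := (E.erase e₁).erase e₂ with hR
    have hR1 : e₁ ∉ R := by simp [hR]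
    have hR2 : e₂ ∉ R := by simp [hR]
    have hER : E = insert e₁ (insert e₂ R) := by
      rw [hR, Finset.insert_erase (by simp [hne, he₂]), Finset.insert_erase he₁]
    have h12 : e₁ ∉ insert e₂ R := by simp [hR1, hne.symm]
    have hRE : ∀ e ∈ R, e ∈ E := fun e he => by rw [hER]; simp [he]
    have hRne : ∀ e ∈ R, e ≠ e₁ ∧ e ≠ e₂ := fun e he =>
      ⟨fun hh => hR1 (hh ▸ he), fun hh => hR2 (hh ▸ he)⟩
    have hx := (hV e₁ he₁).2
    have hy := (hV e₂ he₂).2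
    have hxz : h e₁ ≠ z := fun hh => hz (hh ▸ hx)
    have hyz : h e₂ ≠ z := fun hh => hz (hh ▸ hy)
    -- The name `e₁` is reused for the new edge between the two neighbours, and `e₂` is dropped.
    -- Only cuts with both neighbours on the side away from `z` lose edges, namely two, which is
    -- what `hsplit` allows for.
    set u := Function.update t e₁ (h e₂) with hu
    have hu1 : u e₁ = h e₂ := by simp [hu]
    have huR : ∀ e ∈ R, u e = t e := fun e he => by simp [hu, (hRne e he).1]
    have hcutR : ∀ X, cutDeg u h R X = cutDeg t h R X := fun X =>
      cutDeg_congr huR fun _ _ => rfl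
    obtain ⟨t', h', hr, ho, hz1, hz2⟩ := ihn (insert e₁ R) u h (by
        intro e he
        rcases Finset.mem_insert.1 he with rfl | he
        · exact ⟨by rw [hu1]; simp [hy], hx⟩
        · rw [huR e he]
          exact hV e (hRE e he)) (by
        have h1 : (R.filter fun e => t e = z).card = 2 * n := by
          rw [hER, Finset.filter_insert, if_pos hte₁, Finset.filter_insert, if_pos hte₂,
            Finset.card_insert_of_notMem (by simp [hR1, hne.symm]),
            Finset.card_insert_of_notMem (by simp [hR2])] at hZ
          omega
        rw [Finset.filter_insert, if_neg (by rwa [hu1]), ← h1]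
        congr 1
        exact Finset.filter_congr fun e he => by rw [huR e he]) (by
        intro X hXV hXne hXV'
        have h1 := hc X hXV hXne hXV'
        have hzX : z ∉ X := fun hh => hz (hXV hh)
        have h2 := hsplit X hXV hXV'
        rw [hER, cutDeg_insert h12, cutDeg_insert hR2, hte₁, hte₂] at h1 h2
        rw [cutDeg_insert hR1, hu1, hcutR]
        by_cases a : h e₁ ∈ X <;> by_cases b : h e₂ ∈ X <;> simp [a, b, hzX] at h1 h2 ⊢ <;> omega)
    have hout : ∀ (t₁ h₁ : β → α), (∀ e ∈ R, t₁ e = t' e ∧ h₁ e = h' e) → ∀ X,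
        outDeg t₁ h₁ E X = (if t₁ e₁ ∈ X ∧ h₁ e₁ ∉ X then 1 else 0) +
          ((if t₁ e₂ ∈ X ∧ h₁ e₂ ∉ X then 1 else 0) + outDeg t' h' R X) ∧
        outDeg h₁ t₁ E X = (if h₁ e₁ ∈ X ∧ t₁ e₁ ∉ X then 1 else 0) +
          ((if h₁ e₂ ∈ X ∧ t₁ e₂ ∉ X then 1 else 0) + outDeg h' t' R X) := by
      intro t₁ h₁ hth X
      have ht := fun e he => (hth e he).1
      have hh := fun e he => (hth e he).2
      rw [hER, outDeg_insert h12, outDeg_insert hR2, outDeg_insert h12, outDeg_insert hR2,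
        outDeg_congr ht hh, outDeg_congr hh ht]
      exact ⟨rfl, rfl⟩
    have hor : ∀ (t₁ h₁ : β → α), (∀ e, e ≠ e₁ → e ≠ e₂ → t₁ e = t' e ∧ h₁ e = h' e) →
        (t₁ e₁ = t e₁ ∧ h₁ e₁ = h e₁ ∨ t₁ e₁ = h e₁ ∧ h₁ e₁ = t e₁) →
        (t₁ e₂ = t e₂ ∧ h₁ e₂ = h e₂ ∨ t₁ e₂ = h e₂ ∧ h₁ e₂ = t e₂) →
        IsReorientation t h t₁ h₁ := by
      intro t₁ h₁ hth h1 h2 e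
      by_cases c1 : e = e₁
      · subst c1; exact h1
      by_cases c2 : e = e₂
      · subst c2; exact h2
      have := hr e
      rw [hu, Function.update_of_ne c1] at this
      rwa [(hth e c1 c2).1, (hth e c1 c2).2]
    simp only [outDeg_insert hR1] at ho hz1 hz2
    -- The oriented new edge is replaced by the directed path through `z` between the same ends. No
    -- out-degree of a relevant cut drops, and `z` gains one incoming and one outgoing arc. The two
    -- cases are the two orientations of the new edge.
    rcases hr e₁ with ⟨a, b⟩ | ⟨a, b⟩
    · rw [hu1] at a
      set t₁ := Function.update (Function.update t' e₁ z) e₂ (h e₂) with ht₁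
      set h₁ := Function.update h' e₂ z with hh₁
      have hth : ∀ e, e ≠ e₁ → e ≠ e₂ → t₁ e = t' e ∧ h₁ e = h' e := fun e c1 c2 => by
        simp [ht₁, hh₁, c1, c2]
      have v1 : t₁ e₁ = z := by simp [ht₁, hne.symm]
      have v2 : t₁ e₂ = h e₂ := by simp [ht₁]
      have v3 : h₁ e₁ = h e₁ := by simp [hh₁, hne.symm, b]
      have v4 : h₁ e₂ = z := by simp [hh₁]
      have ho' := hout t₁ h₁ fun e he => hth e (hRne e he).1 (hRne e he).2
      simp only [v1, v2, v3, v4] at ho'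
      refine ⟨t₁, h₁, hor t₁ h₁ hth (by simp [v1, v3, hte₁]) (by simp [v2, v4, hte₂]), ?_, ?_, ?_⟩
      · intro X h1 h2
        have := ho X h1 h2
        rw [a, b] at this
        rw [(ho' X).1]
        by_cases c1 : h e₁ ∈ X <;> by_cases c2 : h e₂ ∈ X <;> by_cases c3 : z ∈ X <;>
          simp [c1, c2, c3] at this ⊢ <;> omega
      · rw [(ho' {z}).1]
        simp [a, b, hxz, hyz] at hz1 ⊢
        omega
      · rw [(ho' {z}).2]
        simp [a, b, hxz, hyz] at hz2 ⊢
        omega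
    · rw [hu1] at b
      set t₁ := Function.update t' e₂ z with ht₁
      set h₁ := Function.update (Function.update h' e₁ z) e₂ (h e₂) with hh₁
      have hth : ∀ e, e ≠ e₁ → e ≠ e₂ → t₁ e = t' e ∧ h₁ e = h' e := fun e c1 c2 => by
        simp [ht₁, hh₁, c1, c2]
      have v1 : h₁ e₁ = z := by simp [hh₁, hne.symm]
      have v2 : h₁ e₂ = h e₂ := by simp [hh₁]
      have v3 : t₁ e₁ = h e₁ := by simp [ht₁, hne.symm, a]
      have v4 : t₁ e₂ = z := by simp [ht₁]
      have ho' := hout t₁ h₁ fun e he => hth e (hRne e he).1 (hRne e he).2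
      simp only [v1, v2, v3, v4] at ho'
      refine ⟨t₁, h₁, hor t₁ h₁ hth (by simp [v1, v3, hte₁]) (by simp [v2, v4, hte₂]), ?_, ?_, ?_⟩
      · intro X h1 h2
        have := ho X h1 h2
        rw [a, b] at this
        rw [(ho' X).1]
        by_cases c1 : h e₁ ∈ X <;> by_cases c2 : h e₂ ∈ X <;> by_cases c3 : z ∈ X <;>
          simp [c1, c2, c3] at this ⊢ <;> omega
      · rw [(ho' {z}).1]
        simp [a, b, hxz, hyz] at hz1 ⊢
        omega
      · rw [(ho' {z}).2]
        simp [a, b, hxz, hyz] at hz2 ⊢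
        omega

/-- Nash-Williams: the edges of a `2 * k`-edge-connected graph can be oriented so that every cut
is left by at least `k` arcs. -/
theorem exists_orientation {k : ℕ} (hk : 1 ≤ k) (V : Finset α) :
    ∀ (E : Finset β) (t h : β → α), (∀ e ∈ E, t e ∈ V ∧ h e ∈ V) →
      CutsGe t h V E (2 * k) → ∃ t' h', IsReorientation t h t' h' ∧
        ∀ X ⊆ V, X.Nonempty → X ≠ V → k ≤ outDeg t' h' E X := by
  induction V using Finset.strongInduction with
  | H V ihV =>
  intro E
  induction E using Finset.strongInduction with
  | H E ihE =>
  intro t h hV hc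
  by_cases hnt : 1 < V.card
  swap
  · refine ⟨t, h, fun e => Or.inl ⟨rfl, rfl⟩, fun X hX hne hXV => (hXV ?_).elim⟩
    refine Finset.eq_of_subset_of_card_le hX ?_
    have := Finset.card_pos.2 hne
    omega
  by_cases hdel : ∃ e ∈ E, CutsGe t h V (E.erase e) (2 * k)
  · obtain ⟨e, he, hce⟩ := hdel
    obtain ⟨t', h', hr, ho⟩ := ihE (E.erase e) (Finset.erase_ssubset he) t h
      (fun a ha => hV a (Finset.mem_of_mem_erase ha)) hce
    exact ⟨t', h', hr, fun X h1 h2 h3 =>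
      (ho X h1 h2 h3).trans (outDeg_mono (Finset.erase_subset _ _) X)⟩
  have hmin : ∀ e ∈ E, ∃ X ⊆ V, X.Nonempty ∧ X ≠ V ∧ ¬(t e ∈ X ↔ h e ∈ X) ∧
      cutDeg t h E X = 2 * k := by
    intro e he
    have : ¬ CutsGe t h V (E.erase e) (2 * k) := fun hh => hdel ⟨e, he, hh⟩
    simp only [CutsGe, not_forall, not_le] at this
    obtain ⟨X, h1, h2, h3, h4⟩ := this
    have h5 := hc X h1 h2 h3
    have h6 := cutDeg_insert (t := t) (h := h) (Finset.notMem_erase e E) X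
    rw [Finset.insert_erase he] at h6
    refine ⟨X, h1, h2, h3, ?_, ?_⟩
    · intro hh
      rw [if_neg (not_not.2 hh)] at h6
      omega
    · split_ifs at h6 <;> omega
  -- Since no edge can be deleted, Mader's lemma supplies a vertex of even degree `2 * k`. Below,
  -- `t₀` and `h₀` turn all its edges away from it.
  obtain ⟨z, hzV, hz⟩ := exists_cutDeg_singleton_eq (by omega) hV hc hnt hmin
  have hVz : insert z (V.erase z) = V := Finset.insert_erase hzV
  set t₀ : β → α := fun e => if h e = z then z else t e with ht₀
  set h₀ : β → α := fun e => if h e = z then t e else h e with hh₀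
  have hr₀ : IsReorientation t h t₀ h₀ := by
    intro e
    by_cases c : h e = z <;> simp [ht₀, hh₀, c]
  have hloop : ∀ e ∈ E, t e ≠ h e := by
    intro e he hh
    obtain ⟨X, -, -, -, h4, -⟩ := hmin e he
    rw [hh] at h4
    exact h4 Iff.rfl
  have hV₀ : ∀ e ∈ E, t₀ e ∈ insert z (V.erase z) ∧ h₀ e ∈ V.erase z := by
    intro e he
    have h1 := hV e he
    have h2 := hloop e he
    rw [hVz, Finset.mem_erase]
    by_cases c : h e = z
    · simp only [ht₀, hh₀, c, if_true]
      rw [c] at h2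
      exact ⟨hzV, h2, h1.1⟩
    · simp only [ht₀, hh₀, c, if_false]
      exact ⟨h1.1, c, h1.2⟩
  have hdeg : (E.filter fun e => t₀ e = z).card = 2 * k := by
    rw [← hz, ← hr₀.cutDeg_eq, cutDeg]
    congr 1
    refine Finset.filter_congr fun e he => ?_
    have h1 : h₀ e ≠ z := Finset.ne_of_mem_erase (hV₀ e he).2
    simp [h1]
  have hne : (V.erase z).Nonempty := by
    rw [← Finset.card_pos, Finset.card_erase_of_mem hzV]
    omega
  obtain ⟨t', h', hr, ho, ho1, ho2⟩ := exists_orientation_of_splitOff hk (Finset.notMem_erase z V)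
    (ihV _ (Finset.erase_ssubset hzV)) k E t₀ h₀ hV₀ hdeg (by
      intro X h1 h2 h3
      rw [hr₀.cutDeg_eq]
      refine hc X (h1.trans (Finset.erase_subset _ _)) h2 ?_
      rintro rfl
      exact Finset.notMem_erase z X (h1 hzV))
  refine ⟨t', h', hr₀.trans hr, fun X hXV hXne hXV' => ?_⟩
  -- The cuts of `{z}` and of its complement are not controlled by the smaller graph; balance at `z`
  -- gives them exactly `k` arcs each way.
  by_cases c1 : (X ∩ V.erase z).Nonempty
  · by_cases c2 : V.erase z ⊆ X
    · have hzX : z ∉ X := fun hh => hXV' (hXV.antisymm (hVz ▸ Finset.insert_subset hh c2))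
      have hX : X = V \ {z} := by
        rw [Finset.sdiff_singleton_eq_erase]
        exact (Finset.subset_erase.2 ⟨hXV, hzX⟩).antisymm c2
      rw [hX, outDeg_sdiff, ho2]
      intro e he
      have := hV e he
      rcases hr₀.trans hr e with ⟨a, b⟩ | ⟨a, b⟩ <;> rw [a, b] <;> tauto
    · exact ho X c1 c2
  · have hX : X = {z} := by
      refine (Finset.subset_singleton_iff.1 fun x hx => ?_).resolve_left hXne.ne_empty
      by_contra hxz
      exact c1 ⟨x, by simpa [hx, hXV hx] using hxz⟩
    rw [hX, ho1]

end Splitting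

/-! ### Edmonds' disjoint branchings -/

section Branchings

variable {α β : Type*}

theorem IsWalk.mono {A B : Set (Arc α β)} (hAB : A ⊆ B) {x y : α} {p : List (Arc α β)}
    (hp : IsWalk A x y p) : IsWalk B x y p := by
  induction hp with
  | nil x => exact IsWalk.nil x
  | cons ha _ ih => exact IsWalk.cons (hAB ha) ih

variable [DecidableEq α] [DecidableEq β]

/-- `InTree t h d U F`: the arcs of `F` form an arborescence on the vertex set `U` that is directed
towards `d`. -/
inductive InTree (t h : β → α) (d : α) : Finset α → Finset β → Prop
  | root : InTree t h d {d} ∅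
  | grow {U : Finset α} {F : Finset β} {e : β} :
      InTree t h d U F → t e ∉ U → h e ∈ U → InTree t h d (insert (t e) U) (insert e F)

theorem InTree.root_mem {t h : β → α} {d : α} {U : Finset α} {F : Finset β}
    (hT : InTree t h d U F) : d ∈ U := by
  induction hT with
  | root => simp
  | grow _ _ _ ih => exact Finset.mem_insert_of_mem ih

theorem InTree.tail_ne_head {t h : β → α} {d : α} {U : Finset α} {F : Finset β}
    (hT : InTree t h d U F) : ∀ e ∈ F, t e ≠ h e := by
  induction hT with
  | root => simp
  | grow _ h1 h2 ih =>
    intro e he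
    rcases Finset.mem_insert.1 he with rfl | he
    · exact fun hh => h1 (hh ▸ h2)
    · exact ih e he

theorem InTree.tail_mem {t h : β → α} {d : α} {U : Finset α} {F : Finset β}
    (hT : InTree t h d U F) : ∀ e ∈ F, t e ∈ U ∧ t e ≠ d := by
  induction hT with
  | root => simp
  | grow hT h1 h2 ih =>
    intro e he
    rcases Finset.mem_insert.1 he with rfl | he
    · exact ⟨by simp, fun hh => h1 (hh ▸ hT.root_mem)⟩
    · exact ⟨Finset.mem_insert_of_mem (ih e he).1, (ih e he).2⟩

theorem InTree.existsUnique_out {t h : β → α} {d : α} {U : Finset α} {F : Finset β}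
    (hT : InTree t h d U F) : ∀ v ∈ U, v ≠ d → ∃! e, e ∈ F ∧ t e = v := by
  induction hT with
  | root => simp
  | @grow U F e hT h1 h2 ih =>
    intro v hv hvd
    rcases Finset.mem_insert.1 hv with rfl | hv
    · refine ⟨e, ⟨by simp, rfl⟩, ?_⟩
      rintro e' ⟨he', hte'⟩
      rcases Finset.mem_insert.1 he' with rfl | he'
      · rfl
      · exact (h1 (hte' ▸ (hT.tail_mem e' he').1)).elim
    · obtain ⟨e', ⟨he', hte'⟩, hu⟩ := ih v hv hvd
      refine ⟨e', ⟨Finset.mem_insert_of_mem he', hte'⟩, ?_⟩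
      rintro e'' ⟨he'', hte''⟩
      rcases Finset.mem_insert.1 he'' with rfl | he''
      · exact (h1 (by rwa [hte''])).elim
      · exact hu e'' ⟨he'', hte''⟩

/-- The arcs of `F`, directed from `t` to `h`. -/
def arcSet (t h : β → α) (F : Finset β) : Set (Arc α β) :=
  {a | a.edge ∈ F ∧ a.tail = t a.edge ∧ a.head = h a.edge}

theorem InTree.exists_path {t h : β → α} {d : α} {U : Finset α} {F : Finset β}
    (hT : InTree t h d U F) : ∀ v ∈ U, ∃ p, IsWalk (arcSet t h F) v d p ∧
      (v :: p.map Arc.head).Nodup ∧ ∀ x ∈ v :: p.map Arc.head, x ∈ U := by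
  induction hT with
  | root =>
    intro v hv
    rw [Finset.mem_singleton] at hv
    subst hv
    exact ⟨[], IsWalk.nil v, by simp, by simp⟩
  | @grow U F e hT h1 h2 ih =>
    have hsub : arcSet t h F ⊆ arcSet t h (insert e F) :=
      fun a ha => ⟨Finset.mem_insert_of_mem ha.1, ha.2⟩
    intro v hv
    rcases Finset.mem_insert.1 hv with rfl | hv
    · obtain ⟨p, hp, hnd, hU⟩ := ih (h e) h2
      refine ⟨⟨e, t e, h e⟩ :: p, IsWalk.cons (a := ⟨e, t e, h e⟩) ⟨by simp, rfl, rfl⟩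
        (hp.mono hsub), ?_, ?_⟩
      · rw [List.map_cons, List.nodup_cons]
        exact ⟨fun hh => h1 (hU _ hh), hnd⟩
      · intro x hx
        rw [List.map_cons] at hx
        rcases List.mem_cons.1 hx with rfl | hx
        · simp
        · exact Finset.mem_insert_of_mem (hU x hx)
    · obtain ⟨p, hp, hnd, hU⟩ := ih v hv
      exact ⟨p, hp.mono hsub, hnd, fun x hx => Finset.mem_insert_of_mem (hU x hx)⟩

/-- All sets of vertices of `V` that do not contain `d` are left by at least `k` arcs. -/
def OutGe (t h : β → α) (V : Finset α) (d : α) (E : Finset β) (k : ℕ) : Prop :=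
  ∀ X ⊆ V, X.Nonempty → d ∉ X → k ≤ outDeg t h E X

theorem outDeg_erase_of_not {t h : β → α} {E : Finset β} {e : β} {X : Finset α}
    (he : ¬(t e ∈ X ∧ h e ∉ X)) : outDeg t h (E.erase e) X = outDeg t h E X := by
  by_cases heE : e ∈ E
  · have := outDeg_insert (t := t) (h := h) (Finset.notMem_erase e E) X
    rw [Finset.insert_erase heE, if_neg he, zero_add] at this
    exact this.symm
  · rw [Finset.erase_eq_of_notMem heE]

theorem outDeg_le_erase {t h : β → α} {E : Finset β} (e : β) (X : Finset α) :
    outDeg t h E X ≤ outDeg t h (E.erase e) X + 1 := by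
  by_cases heE : e ∈ E
  · have := outDeg_insert (t := t) (h := h) (Finset.notMem_erase e E) X
    rw [Finset.insert_erase heE] at this
    split_ifs at this <;> omega
  · rw [Finset.erase_eq_of_notMem heE]
    omega

/-- An arborescence towards `d` whose removal leaves out-degrees of at least `k` can be extended. -/
theorem InTree.exists_extension {t h : β → α} {V : Finset α} {d : α} {E : Finset β} {k : ℕ}
    (hV : ∀ e ∈ E, t e ∈ V ∧ h e ∈ V) (hE : OutGe t h V d E (k + 1))
    {U : Finset α} {F : Finset β} (hT : InTree t h d U F) (hU : U ⊂ V)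
    (hF : OutGe t h V d (E \ F) k) :
    ∃ e ∈ E \ F, t e ∈ V ∧ t e ∉ U ∧ h e ∈ U ∧ OutGe t h V d (E \ insert e F) k := by
  have herase : ∀ e, E \ insert e F = (E \ F).erase e := fun e => by
    ext x; simp only [Finset.mem_sdiff, Finset.mem_insert, Finset.mem_erase]; tauto
  have hEF : ∀ A, outDeg t h (E \ F) (A \ U) = outDeg t h E (A \ U) := by
    intro A
    unfold outDeg
    congr 1
    ext e
    simp only [Finset.mem_filter, Finset.mem_sdiff]
    constructor
    · rintro ⟨⟨a, -⟩, b⟩; exact ⟨a, b⟩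
    · rintro ⟨a, b⟩; exact ⟨⟨a, fun hh => b.1.2 (hT.tail_mem e hh).1⟩, b⟩
  -- The critical sets, which can spare no arc. Subsets of `U` are irrelevant because the new arc
  -- has its tail outside `U`.
  set S := V.powerset.filter fun A => d ∉ A ∧ ¬ A ⊆ U ∧ outDeg t h (E \ F) A = k with hS
  have hfin : ∀ e ∈ E \ F, t e ∉ U → (∀ B ∈ S, t e ∈ B → h e ∈ B) →
      OutGe t h V d (E \ insert e F) k := by
    intro e he hte hB X hXV hXne hdX
    rw [herase]
    by_cases hl : t e ∈ X ∧ h e ∉ X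
    · have h1 := outDeg_le_erase (t := t) (h := h) (E := E \ F) e X
      have h2 := hF X hXV hXne hdX
      have h3 : outDeg t h (E \ F) X ≠ k := by
        intro hk
        refine hl.2 (hB X ?_ hl.1)
        simp only [hS, Finset.mem_filter, Finset.mem_powerset]
        exact ⟨hXV, hdX, fun hh => hte (hh hl.1), hk⟩
      omega
    · rw [outDeg_erase_of_not hl]
      exact hF X hXV hXne hdX
  by_cases hSne : S.Nonempty
  · obtain ⟨A, hA, hAmin⟩ := Finset.exists_min_image S Finset.card hSne
    simp only [hS, Finset.mem_filter, Finset.mem_powerset] at hA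
    obtain ⟨hAV, hdA, hAU, hAk⟩ := hA
    -- No arc of `F` leaves `A \ U`, so at least `k + 1` remaining arcs do, but only `k` leave `A`.
    -- Some arc therefore runs from `A \ U` into `A ∩ U`.
    have h1 : outDeg t h (E \ F) A < outDeg t h (E \ F) (A \ U) := by
      rw [hEF, hAk]
      exact hE _ (Finset.sdiff_subset.trans hAV) (Finset.sdiff_nonempty.2 hAU) (by simp [hdA])
    obtain ⟨e, he, hen⟩ := Finset.exists_mem_notMem_of_card_lt_card h1
    simp only [Finset.mem_filter, Finset.mem_sdiff, not_and, not_not] at he hen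
    obtain ⟨heEF, ⟨hteA, hteU⟩, hhe⟩ := he
    have hheA := hen heEF hteA
    refine ⟨e, by simpa using heEF, hAV hteA, hteU, hhe hheA, hfin e (by simpa using heEF) hteU ?_⟩
    intro B hB hteB
    by_contra hheB
    simp only [hS, Finset.mem_filter, Finset.mem_powerset] at hB
    obtain ⟨hBV, hdB, hBU, hBk⟩ := hB
    -- If the arc left a critical set `B`, then `A ∩ B` would be critical by submodularity, and
    -- smaller than the minimal `A`.
    have h2 := outDeg_submodular t h (E \ F) A B
    have h3 := hF (A ∪ B) (Finset.union_subset hAV hBV) ⟨t e, by simp [hteA]⟩ (by simp [hdA, hdB])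
    have h4 := hF (A ∩ B) (Finset.inter_subset_left.trans hAV) ⟨t e, by simp [hteA, hteB]⟩
      (by simp [hdA])
    have h5 := hAmin (A ∩ B) (by
      simp only [hS, Finset.mem_filter, Finset.mem_powerset]
      refine ⟨Finset.inter_subset_left.trans hAV, by simp [hdA], fun hh => hteU (hh ?_), by omega⟩
      simp [hteA, hteB])
    have h6 : A ∩ B ⊂ A :=
      (Finset.ssubset_iff_of_subset Finset.inter_subset_left).2 ⟨h e, hheA, by simp [hheB]⟩
    have := Finset.card_lt_card h6
    omega
  · rw [Finset.not_nonempty_iff_eq_empty] at hSne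
    have h1 := hE (V \ U) Finset.sdiff_subset (Finset.sdiff_nonempty.2 hU.2)
      (by simp [hT.root_mem])
    rw [← hEF] at h1
    obtain ⟨e, he⟩ := Finset.card_pos.1 (lt_of_lt_of_le (Nat.succ_pos k) h1)
    simp only [Finset.mem_filter, Finset.mem_sdiff, not_and, not_not] at he
    obtain ⟨⟨heE, heF⟩, ⟨hteV, hteU⟩, hhe⟩ := he
    refine ⟨e, by simp [heE, heF], hteV, hteU, hhe (hV e heE).2, hfin e (by simp [heE, heF]) hteU ?_⟩
    simp [hSne]

/-- Edmonds, for one spanning arborescence. -/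
theorem exists_inTree {t h : β → α} {V : Finset α} {d : α} {E : Finset β} {k : ℕ} (hd : d ∈ V)
    (hV : ∀ e ∈ E, t e ∈ V ∧ h e ∈ V) (hE : OutGe t h V d E (k + 1)) :
    ∃ F ⊆ E, InTree t h d V F ∧ OutGe t h V d (E \ F) k := by
  suffices H : ∀ n U F, InTree t h d U F → U ⊆ V → F ⊆ E → (V \ U).card = n →
      OutGe t h V d (E \ F) k → ∃ F ⊆ E, InTree t h d V F ∧ OutGe t h V d (E \ F) k by
    refine H _ {d} ∅ InTree.root (by simpa using hd) (by simp) rfl ?_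
    rw [Finset.sdiff_empty]
    exact fun X h1 h2 h3 => (Nat.le_succ k).trans (hE X h1 h2 h3)
  intro n
  induction n with
  | zero =>
    intro U F hT hUV hFE hc hF
    have : U = V := hUV.antisymm (Finset.sdiff_eq_empty_iff_subset.1 (Finset.card_eq_zero.1 hc))
    exact ⟨F, hFE, this ▸ hT, hF⟩
  | succ n ih =>
    intro U F hT hUV hFE hc hF
    have hss : U ⊂ V := by
      refine ⟨hUV, fun hh => ?_⟩
      rw [Finset.sdiff_eq_empty_iff_subset.2 hh] at hc
      simp at hc
    obtain ⟨e, he, hteV, hteU, hheU, hF'⟩ := hT.exists_extension hV hE hss hF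
    refine ih _ _ (hT.grow hteU hheU) (Finset.insert_subset hteV hUV)
      (Finset.insert_subset (Finset.mem_sdiff.1 he).1 hFE) ?_ hF'
    have h1 : V \ insert (t e) U = (V \ U).erase (t e) := by
      ext x; simp only [Finset.mem_sdiff, Finset.mem_insert, Finset.mem_erase]; tauto
    rw [h1, Finset.card_erase_of_mem (by simp [hteV, hteU]), hc]
    rfl

/-- Edmonds' disjoint branchings theorem. -/
theorem exists_disjoint_inTrees {t h : β → α} {V : Finset α} {d : α} (hd : d ∈ V) (k : ℕ) :
    ∀ E : Finset β, (∀ e ∈ E, t e ∈ V ∧ h e ∈ V) → OutGe t h V d E k →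
      ∃ F : ℕ → Finset β, (∀ i < k, F i ⊆ E ∧ InTree t h d V (F i)) ∧
        ∀ i < k, ∀ j < k, i ≠ j → Disjoint (F i) (F j) := by
  induction k with
  | zero => exact fun E _ _ => ⟨fun _ => ∅, by simp, by simp⟩
  | succ k ih =>
    intro E hV hE
    obtain ⟨F₀, hF₀E, hF₀, hrest⟩ := exists_inTree hd hV hE
    obtain ⟨F, h1, h2⟩ := ih (E \ F₀) (fun e he => hV e (Finset.mem_sdiff.1 he).1) hrest
    have h3 : ∀ i < k, Disjoint F₀ (F i) := fun i hi =>
      Finset.disjoint_sdiff.mono_right (h1 i hi).1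
    refine ⟨fun i => if i = k then F₀ else F i, fun i hi => ?_, fun i hi j hj hij => ?_⟩
    · by_cases hik : i = k
      · simp [hik, hF₀E, hF₀]
      · have := h1 i (by omega)
        simp only [hik, if_false]
        exact ⟨this.1.trans Finset.sdiff_subset, this.2⟩
    · by_cases hik : i = k <;> by_cases hjk : j = k
      · omega
      · simp only [hik, hjk, if_true, if_false]
        exact h3 j (by omega)
      · simp only [hik, hjk, if_true, if_false]
        exact (h3 i (by omega)).symm
      · simp only [hik, hjk, if_false]
        exact h2 i (by omega) j (by omega) hij

end Branchings

/-! ### Existence of the arborescences -/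

section Existence

variable {α β : Type*}

theorem IsWalk.exists_crossing {A : Set (Arc α β)} {x y : α} {p : List (Arc α β)}
    (hp : IsWalk A x y p) {X : Set α} (hx : x ∈ X) (hy : y ∉ X) :
    ∃ a ∈ p, a ∈ A ∧ a.tail ∈ X ∧ a.head ∉ X := by
  induction hp with
  | nil x => exact (hy hx).elim
  | @cons a y p ha hp ih =>
    by_cases hh : a.head ∈ X
    · obtain ⟨b, hb, h2⟩ := ih hh hy
      exact ⟨b, List.mem_cons_of_mem _ hb, h2⟩
    · exact ⟨a, List.mem_cons_self, ha, hx, hh⟩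

/-- The easy half of Menger's theorem: each of the edge-disjoint paths crosses the cut in an edge of
its own. -/
theorem IsEdgeConnected.cutsGe [DecidableEq α] {G : Graph α β} {K : ℕ} (hG : IsEdgeConnected G K)
    {V : Finset α} {E : Finset β} (hV : ∀ x, x ∈ V ↔ x ∈ V(G)) (hE : ∀ e, e ∈ E ↔ e ∈ E(G))
    {t h : β → α} (hth : ∀ e ∈ E, G.IsLink e (t e) (h e)) : CutsGe t h V E K := by
  intro X hXV hXne hXV'
  obtain ⟨x, hx⟩ := hXne
  obtain ⟨y, hyV, hy⟩ : ∃ y ∈ V, y ∉ X := by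
    by_contra hno
    push Not at hno
    exact hXV' (hXV.antisymm hno)
  obtain ⟨p, hp, hdis⟩ := hG x ((hV x).1 (hXV hx)) y ((hV y).1 hyV) fun hh => hy (hh ▸ hx)
  choose a hap haA hat hah using fun i =>
    (hp i).1.exists_crossing (X := (X : Set α)) (by simpa using hx) (by simpa using hy)
  have hinj : Function.Injective fun i => (a i).edge := by
    intro i j hij
    by_contra hne
    exact hdis i j hne _ (hap i) _ (hap j) hij
  have := Finset.card_le_card_of_injOn (s := Finset.univ)
    (t := E.filter fun e => ¬(t e ∈ X ↔ h e ∈ X)) (fun i => (a i).edge) (by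
      intro i _
      have hl : G.IsLink (a i).edge (a i).tail (a i).head := haA i
      have heE : (a i).edge ∈ E := (hE _).2 hl.edge_mem
      have h1 := hat i
      have h2 := hah i
      simp only [Finset.coe_filter, Set.mem_ofPred_eq, Finset.mem_coe] at h1 h2 ⊢
      refine ⟨heE, ?_⟩
      rcases hl.eq_and_eq_or_eq_and_eq (hth _ heE) with ⟨c1, c2⟩ | ⟨c1, c2⟩ <;>
        rw [← c1, ← c2] <;> tauto) hinj.injOn
  simpa [cutDeg] using this

theorem InTree.isArborescence [DecidableEq α] [DecidableEq β] {G : Graph α β} {d : α}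
    {V : Finset α} {F : Finset β} {t h : β → α} (hV : ∀ x, x ∈ V ↔ x ∈ V(G))
    (hth : ∀ e ∈ F, G.IsLink e (t e) (h e))
    (hT : InTree t h d V F) : IsArborescence G d (arcSet t h F) where
  subset a ha := by
    show G.IsLink a.edge a.tail a.head
    rw [ha.2.1, ha.2.2]
    exact hth _ ha.1
  root a ha := by
    rw [ha.2.1]
    exact (hT.tail_mem _ ha.1).2
  existsUnique_out v hv hvd := by
    obtain ⟨e, ⟨he, hte⟩, hu⟩ := hT.existsUnique_out v ((hV v).2 hv) hvd
    refine ⟨⟨e, t e, h e⟩, ⟨⟨he, rfl, rfl⟩, hte⟩, ?_⟩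
    rintro ⟨e', x, y⟩ ⟨⟨h1, h2, h3⟩, h4⟩
    dsimp only at h1 h2 h3 h4
    obtain rfl := hu e' ⟨h1, h2 ▸ h4⟩
    rw [h2, h3]
  exists_path v hv := by
    obtain ⟨p, h1, h2, -⟩ := hT.exists_path v ((hV v).2 hv)
    exact ⟨p, h1, h2⟩

theorem exists_isDupFamily {G : Graph α β} (hVf : V(G).Finite) (hEf : E(G).Finite) {d : α}
    (hd : d ∈ V(G)) {s : ℕ} (hs : 1 ≤ s) (hG : IsEdgeConnected G (2 * s)) :
    ∃ T : ℕ → Set (Arc α β), IsDupFamily G d s T := by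
  classical
  have hVm : ∀ x, x ∈ hVf.toFinset ↔ x ∈ V(G) := fun x => hVf.mem_toFinset
  have hEm : ∀ e, e ∈ hEf.toFinset ↔ e ∈ E(G) := fun e => hEf.mem_toFinset
  set V := hVf.toFinset
  set E := hEf.toFinset
  have hends : ∀ e, ∃ x y, e ∈ E → G.IsLink e x y := by
    intro e
    by_cases he : e ∈ E
    · obtain ⟨x, y, hxy⟩ := Graph.exists_isLink_of_mem_edgeSet ((hEm e).1 he)
      exact ⟨x, y, fun _ => hxy⟩
    · exact ⟨d, d, fun hh => (he hh).elim⟩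
  choose t₀ h₀ hl₀ using hends
  have hVe₀ : ∀ e ∈ E, t₀ e ∈ V ∧ h₀ e ∈ V := fun e he =>
    ⟨(hVm _).2 (hl₀ e he).left_mem, (hVm _).2 (hl₀ e he).right_mem⟩
  obtain ⟨t, h, hr, ho⟩ := exists_orientation hs V E t₀ h₀ hVe₀ (hG.cutsGe hVm hEm hl₀)
  have hl : ∀ e ∈ E, G.IsLink e (t e) (h e) := by
    intro e he
    rcases hr e with ⟨a, b⟩ | ⟨a, b⟩ <;> rw [a, b]
    exacts [hl₀ e he, (hl₀ e he).symm]
  have hVe : ∀ e ∈ E, t e ∈ V ∧ h e ∈ V := fun e he =>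
    ⟨(hVm _).2 (hl e he).left_mem, (hVm _).2 (hl e he).right_mem⟩
  have hdV : d ∈ V := (hVm d).2 hd
  have ho1 : OutGe t h V d E s := fun X h1 h2 h3 => ho X h1 h2 fun hh => h3 (hh ▸ hdV)
  -- Arcs leaving `X` in the reversal are arcs leaving `V \ X` in the orientation.
  have ho2 : OutGe h t V d E s := by
    intro X h1 h2 h3
    rw [← outDeg_sdiff hVe]
    refine ho _ Finset.sdiff_subset ⟨d, by simp [hdV, h3]⟩ fun hh => ?_
    obtain ⟨x, hx⟩ := h2
    have := h1 hx
    rw [← hh] at this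
    simp [hx] at this
  obtain ⟨F, hF, hFd⟩ := exists_disjoint_inTrees hdV s E hVe ho1
  obtain ⟨F', hF', hFd'⟩ := exists_disjoint_inTrees hdV s E (fun e he => (hVe e he).symm) ho2
  -- On a loop, an arc and its reverse would coincide, and the two halves might not be arc-disjoint.
  have hloop : ∀ e, ∀ i < s, e ∈ F i → t e ≠ h e := fun e i hi => (hF i hi).2.tail_ne_head e
  refine ⟨fun i => if i ≤ s then arcSet t h (F (i - 1)) else arcSet h t (F' (i - s - 1)), ?_, ?_,
    ?_, ?_⟩
  · intro i hi
    rw [Finset.mem_Icc] at hi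
    split_ifs with his
    · exact (hF (i - 1) (by omega)).2.isArborescence hVm fun e he =>
        hl e ((hF (i - 1) (by omega)).1 he)
    · exact (hF' (i - s - 1) (by omega)).2.isArborescence hVm fun e he =>
        (hl e ((hF' (i - s - 1) (by omega)).1 he)).symm
  · intro i hi j hj hij
    rw [Finset.mem_Icc] at hi hj
    rw [Set.disjoint_left]
    intro a ha hb
    split_ifs at ha hb with h1 h2 h3
    · exact Finset.disjoint_left.1 (hFd (i - 1) (by omega) (j - 1) (by omega) (by omega)) ha.1 hb.1
    · exact hloop a.edge (i - 1) (by omega) ha.1 (by rw [← ha.2.1, hb.2.1])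
    · exact hloop a.edge (j - 1) (by omega) hb.1 (by rw [← hb.2.1, ha.2.1])
    · exact Finset.disjoint_left.1 (hFd' (i - s - 1) (by omega) (j - s - 1) (by omega)
        (by omega)) ha.1 hb.1
  · intro i hi j hj hij a ha hb
    rw [Finset.mem_Icc] at hi hj
    rw [if_pos hi.2] at ha
    rw [if_pos hj.2] at hb
    exact Finset.disjoint_left.1 (hFd (i - 1) (by omega) (j - 1) (by omega) (by omega)) ha.1 hb.1
  · intro i hi j hj hij a ha hb
    rw [Finset.mem_Icc] at hi hj
    rw [if_neg (by omega)] at ha hb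
    exact Finset.disjoint_left.1 (hFd' (i - s - 1) (by omega) (j - s - 1) (by omega)
      (by omega)) ha.1 hb.1

end Existence

/-! ### Following an arborescence up to a failed arc -/

section Following

variable {α β : Type*} {G : Graph α β} {d : α}

theorem IsArborescence.link {T : Set (Arc α β)} (hT : IsArborescence G d T) {a : Arc α β}
    (ha : a ∈ T) : G.IsLink a.edge a.tail a.head := hT.subset ha

theorem IsArborescence.eq_of_tail_eq {T : Set (Arc α β)} (hT : IsArborescence G d T)
    {a b : Arc α β} (ha : a ∈ T) (hb : b ∈ T) (h : a.tail = b.tail) : a = b :=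
  (hT.existsUnique_out a.tail (hT.link ha).left_mem (hT.root a ha)).unique ⟨ha, rfl⟩ ⟨hb, h.symm⟩

/-- With both arcs present, out-arcs being unique, a walk from either end would go back and forth
forever and never reach `d`. -/
theorem IsArborescence.reverse_notMem {T : Set (Arc α β)} (hT : IsArborescence G d T)
    {a : Arc α β} (ha : a ∈ T) : a.reverse ∉ T := by
  intro hr
  have key : ∀ {v y : α} {p : List (Arc α β)}, IsWalk T v y p → y = d →
      v ≠ a.tail ∧ v ≠ a.head := by
    intro v y p hp
    induction hp with
    | nil x => rintro rfl; exact ⟨(hT.root a ha).symm, (hT.root _ hr).symm⟩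
    | @cons b y p hb _ ih =>
      intro hy
      have := ih hy
      refine ⟨fun hh => this.2 ?_, fun hh => this.1 ?_⟩
      · rw [hT.eq_of_tail_eq hb ha hh]
      · rw [hT.eq_of_tail_eq hb hr hh]; rfl
  obtain ⟨p, hp, -⟩ := hT.exists_path a.tail (hT.link ha).left_mem
  exact (key hp rfl).1 rfl

theorem eq_or_eq_reverse {a b : Arc α β} (ha : G.IsLink a.edge a.tail a.head)
    (hb : G.IsLink b.edge b.tail b.head) (h : a.edge = b.edge) : b = a ∨ b = a.reverse := by
  rw [h] at ha
  rcases hb.eq_and_eq_or_eq_and_eq ha with ⟨h1, h2⟩ | ⟨h1, h2⟩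
  · exact Or.inl (Arc.ext h.symm h1 h2)
  · exact Or.inr (Arc.ext h.symm h1 h2)

/-- Following the active arcs of `T` from `v`, one arrives at the tail of the failed arc `a`. -/
inductive Hits (T : Set (Arc α β)) (F : Finset β) : α → Arc α β → Prop
  | here {a : Arc α β} : a ∈ T → a.edge ∈ F → Hits T F a.tail a
  | there {a b : Arc α β} : b ∈ T → b.edge ∉ F → Hits T F b.head a → Hits T F b.tail a

/-- Following the active arcs of `T` from `v`, one arrives at `d`. -/
inductive Reaches (T : Set (Arc α β)) (F : Finset β) (d : α) : α → Prop
  | root : Reaches T F d d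
  | there {b : Arc α β} : b ∈ T → b.edge ∉ F → Reaches T F d b.head → Reaches T F d b.tail

theorem Hits.mem {T : Set (Arc α β)} {F : Finset β} {v : α} {a : Arc α β} (h : Hits T F v a) :
    a ∈ T ∧ a.edge ∈ F := by
  induction h with
  | here h1 h2 => exact ⟨h1, h2⟩
  | there _ _ _ ih => exact ih

theorem IsArborescence.reaches_or_hits {T : Set (Arc α β)} (hT : IsArborescence G d T)
    (F : Finset β) {v : α} (hv : v ∈ V(G)) : Reaches T F d v ∨ ∃ a, Hits T F v a := by
  have key : ∀ {v y : α} {p : List (Arc α β)}, IsWalk T v y p → y = d →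
      Reaches T F d v ∨ ∃ a, Hits T F v a := by
    intro v y p hp
    induction hp with
    | nil x => rintro rfl; exact Or.inl Reaches.root
    | @cons b y p hb _ ih =>
      intro hy
      by_cases hF : b.edge ∈ F
      · exact Or.inr ⟨b, Hits.here hb hF⟩
      · rcases ih hy with h | ⟨a, h⟩
        · exact Or.inl (h.there hb hF)
        · exact Or.inr ⟨a, h.there hb hF⟩
  obtain ⟨p, hp, -⟩ := hT.exists_path v hv
  exact key hp rfl

/-- If, after every failed arc of `T` in `B`, following `T` further on hits another failed arc, then
the last failed arc is not in `B`. -/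
theorem IsArborescence.exists_failed_notMem {T : Set (Arc α β)} (hT : IsArborescence G d T)
    {F : Finset β} {B : Set (Arc α β)} (hB : ∀ b ∈ T, b ∈ B → ∃ a, Hits T F b.head a)
    {v : α} (hv : v ∈ V(G)) (hh : ∃ a, Hits T F v a) : ∃ a ∈ T, a.edge ∈ F ∧ a ∉ B := by
  have key : ∀ {v y : α} {p : List (Arc α β)}, IsWalk T v y p → y = d →
      (∃ a, Hits T F v a) → ∃ a ∈ T, a.edge ∈ F ∧ a ∉ B := by
    intro v y p hp
    induction hp with
    | nil x =>
      rintro rfl ⟨a, ha⟩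
      generalize hx : x = w at ha
      cases ha with
      | here h1 h2 => exact (hT.root _ h1 hx.symm).elim
      | there h1 _ _ => exact (hT.root _ h1 hx.symm).elim
    | @cons b y p hb _ ih =>
      rintro hy ⟨a, ha⟩
      generalize hx : b.tail = w at ha
      cases ha with
      | here h1 h2 =>
        obtain rfl := hT.eq_of_tail_eq hb h1 hx
        by_cases hbB : b ∈ B
        · exact ih hy (hB b hb hbB)
        · exact ⟨b, hb, h2, hbB⟩
      | there h1 h2 h3 =>
        obtain rfl := hT.eq_of_tail_eq hb h1 hx
        exact ih hy ⟨a, h3⟩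
  obtain ⟨p, hp, -⟩ := hT.exists_path v hv
  exact key hp rfl hh

end Following

/-! ### Runs of the scheme, deliveries and the number of copies -/

section Runs

variable {α β : Type*} {G : Graph α β} {d : α} {s : ℕ} {T : ℕ → Set (Arc α β)} {F : Finset β}

theorem DupRun.of_reaches {i : ℕ} (hT : IsArborescence G d (T i)) {v : α}
    (h : Reaches (T i) F d v) : DupRun d s T F v i 0 1 := by
  induction h with
  | root => exact DupRun.deliver i
  | there h1 h2 _ ih => exact DupRun.forward (hT.root _ h1) h1 h2 ih

theorem DupRun.of_hits {i : ℕ} (hT : IsArborescence G d (T i)) {v : α} {a : Arc α β}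
    (h : Hits (T i) F v a) {c n : ℕ} (hr : DupRun d s T F a.tail i c n) :
    DupRun d s T F v i c n := by
  induction h with
  | here _ _ => exact hr
  | there h1 h2 _ ih => exact DupRun.forward (hT.root _ h1) h1 h2 (ih hr)

/-- Case analysis with the vertex kept as a variable, whereas the constructors have `a.tail` in its
place. -/
theorem DupRun.inversion {v : α} {i c n : ℕ} (h : DupRun d s T F v i c n) :
    (v = d ∧ c = 0 ∧ n = 1) ∨
    (∃ a ∈ T i, a.tail = v ∧ v ≠ d ∧ a.edge ∉ F ∧ DupRun d s T F a.head i c n) ∨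
    ∃ a ∈ T i, a.tail = v ∧ v ≠ d ∧ a.edge ∈ F ∧ ∃ c' n' : ℕ → ℕ,
      (∀ j ∈ dupNext s T i a, DupRun d s T F v j (c' j) (n' j)) ∧
      c = dupCreated s i + ∑ j ∈ dupNext s T i a, c' j ∧ n = ∑ j ∈ dupNext s T i a, n' j := by
  cases h with
  | deliver => exact Or.inl ⟨rfl, rfl, rfl⟩
  | forward h1 h2 h3 h4 => exact Or.inr (Or.inl ⟨_, h2, rfl, h1, h3, h4⟩)
  | reroute c' n' h1 h2 h3 h4 => exact Or.inr (Or.inr ⟨_, h2, rfl, h1, h3, c', n', h4, rfl, rfl⟩)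

theorem dupNext_subset {i : ℕ} (hi : i ∈ Finset.Icc 1 (2 * s)) {a : Arc α β} {j : ℕ}
    (hj : j ∈ dupNext s T i a) : j ∈ Finset.Icc 1 (2 * s) := by
  classical
  rw [Finset.mem_Icc] at hi
  unfold dupNext at hj
  split_ifs at hj
  · rcases Finset.mem_insert.1 hj with rfl | hj
    · rw [Finset.mem_Icc]; omega
    · exact (Finset.mem_filter.1 hj).1
  · rw [Finset.mem_Icc] at hj ⊢; omega
  · simp at hj

/-- A vertex other than `d` has a single out-arc in `T i`, either failed or active, so every step of
a run is forced. -/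
theorem DupRun.unique (hT : IsDupFamily G d s T) {v : α} {i c n : ℕ}
    (h : DupRun d s T F v i c n) : i ∈ Finset.Icc 1 (2 * s) → ∀ c' n' : ℕ,
      DupRun d s T F v i c' n' → c' = c ∧ n' = n := by
  induction h with
  | deliver i =>
    intro hi c' n' h'
    rcases h'.inversion with h1 | ⟨a, -, -, h1, -⟩ | ⟨a, -, -, h1, -⟩
    · exact h1.2
    · exact (h1 rfl).elim
    · exact (h1 rfl).elim
  | @forward i c n a h1 h2 h3 _ ih =>
    intro hi c' n' h'
    have hTi := hT.arborescence i hi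
    rcases h'.inversion with h4 | ⟨b, hb, htb, -, -, h5⟩ | ⟨b, hb, htb, -, hbF, -⟩
    · exact (h1 h4.1).elim
    · obtain rfl := hTi.eq_of_tail_eq hb h2 htb
      exact ih hi _ _ h5
    · obtain rfl := hTi.eq_of_tail_eq hb h2 htb
      exact (h3 hbF).elim
  | @reroute i a c n h1 h2 h3 _ ih =>
    intro hi c' n' h'
    have hTi := hT.arborescence i hi
    rcases h'.inversion with h4 | ⟨b, hb, htb, -, hbF, -⟩ | ⟨b, hb, htb, -, -, c'', n'', h5, rfl, rfl⟩
    · exact (h1 h4.1).elim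
    · obtain rfl := hTi.eq_of_tail_eq hb h2 htb
      exact (hbF h3).elim
    · obtain rfl := hTi.eq_of_tail_eq hb h2 htb
      have h6 := fun j hj => ih j hj (dupNext_subset hi hj) _ _ (h5 j hj)
      exact ⟨by rw [Finset.sum_congr rfl fun j hj => (h6 j hj).1],
        Finset.sum_congr rfl fun j hj => (h6 j hj).2⟩

/-- The last `s` arborescences do not create copies. -/
theorem exists_run_last (hT : IsDupFamily G d s T) (F : Finset β) {l : ℕ}
    (hl : l ∈ Finset.Icc (s + 1) (2 * s)) {v : α} (hv : v ∈ V(G)) :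
    ∃ n, DupRun d s T F v l 0 n ∧ (n = 0 → ∃ b, Hits (T l) F v b) := by
  rw [Finset.mem_Icc] at hl
  have hTl := hT.arborescence l (Finset.mem_Icc.2 (by omega))
  rcases hTl.reaches_or_hits F hv with h | ⟨b, h⟩
  · exact ⟨1, DupRun.of_reaches hTl h, by simp⟩
  · refine ⟨0, DupRun.of_hits hTl h ?_, fun _ => ⟨b, h⟩⟩
    have hnext : dupNext s T l b = ∅ := by
      unfold dupNext
      rw [if_neg (by omega), if_neg (by omega)]
    have hcr : dupCreated s l = 0 := by
      unfold dupCreated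
      rw [if_neg (by omega), if_neg (by omega)]
    have := DupRun.reroute (s := s) (fun _ => 0) (fun _ => 0) (hTl.root b h.mem.1) h.mem.1
      h.mem.2 (by rw [hnext]; simp)
    simpa [hnext, hcr] using this

theorem exists_run_of_hits_middle (hs : 1 ≤ s) (hT : IsDupFamily G d s T) {v : α} {a : Arc α β}
    (ha : Hits (T s) F v a) :
    ∃ n, DupRun d s T F v s (s - 1) n ∧
      (n = 0 → ∀ l ∈ Finset.Icc (s + 1) (2 * s), ∃ b, Hits (T l) F a.tail b) := by
  have hTs := hT.arborescence s (Finset.mem_Icc.2 (by omega))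
  have hav := (hTs.link ha.mem.1).left_mem
  choose! n hn hn0 using fun l hl => exists_run_last hT F (l := l) hl hav
  have hnext : dupNext s T s a = Finset.Icc (s + 1) (2 * s) := by
    unfold dupNext
    rw [if_neg (by omega), if_pos rfl]
  have hcr : dupCreated s s = s - 1 := by
    unfold dupCreated
    rw [if_neg (by omega), if_pos rfl]
  have hrun := DupRun.reroute (s := s) (fun _ => 0) n (hTs.root a ha.mem.1) ha.mem.1
      ha.mem.2 (by rw [hnext]; exact hn)
  rw [hnext, hcr, Finset.sum_const_zero, add_zero] at hrun
  exact ⟨_, DupRun.of_hits hTs ha hrun, fun h l hl => hn0 l hl (Finset.sum_eq_zero_iff.1 h l hl)⟩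

/-- The bounced copy continues on one of the last `s` arborescences, if at all, and creates nothing
more. So the count grows by exactly one, and without deliveries the bounced copy too has hit a
failed arc. -/
theorem exists_run_of_hits_first (hT : IsDupFamily G d s T) {i : ℕ} (hi : 1 ≤ i) (his : i < s)
    {v : α} {a : Arc α β} (ha : Hits (T i) F v a) {c n : ℕ}
    (hr : DupRun d s T F a.tail (i + 1) c n) :
    ∃ n', DupRun d s T F v i (c + 1) n' ∧ (n' = 0 → n = 0 ∧
      ∀ l ∈ Finset.Icc (s + 1) (2 * s), a.reverse ∈ T l → ∃ b, Hits (T l) F a.tail b) := by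
  classical
  have hTi := hT.arborescence i (Finset.mem_Icc.2 (by omega))
  have hav := (hTi.link ha.mem.1).left_mem
  choose! m hm hm0 using fun l hl => exists_run_last hT F (l := l) hl hav
  set L := (Finset.Icc 1 (2 * s)).filter fun l => a.reverse ∈ T l with hL
  have hLs : ∀ l ∈ L, l ∈ Finset.Icc (s + 1) (2 * s) := by
    intro l hl
    simp only [hL, Finset.mem_filter, Finset.mem_Icc] at hl ⊢
    refine ⟨?_, hl.1.2⟩
    by_contra hls
    by_cases hil : i = l
    · exact hTi.reverse_notMem ha.mem.1 (hil ▸ hl.2)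
    · exact hT.notShare_first i (Finset.mem_Icc.2 (by omega)) l (Finset.mem_Icc.2 (by omega)) hil
        a ha.mem.1 hl.2
  have hiL : i + 1 ∉ L := fun hh => by
    have := Finset.mem_Icc.1 (hLs _ hh)
    omega
  have hLne : ∀ l ∈ L, l ≠ i + 1 := fun l hl hh => hiL (hh ▸ hl)
  have hnext : dupNext s T i a = insert (i + 1) L := by
    unfold dupNext
    rw [if_pos his, hL]
  have hcr : dupCreated s i = 1 := by
    unfold dupCreated
    rw [if_pos his]
  have hrun := DupRun.reroute (s := s) (fun j => if j = i + 1 then c else 0)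
    (fun j => if j = i + 1 then n else m j) (hTi.root a ha.mem.1) ha.mem.1 ha.mem.2 (by
      rw [hnext]
      intro j hj
      rcases Finset.mem_insert.1 hj with rfl | hj
      · simpa using hr
      · simpa [hLne j hj] using hm j (hLs j hj))
  have hc : (∑ j ∈ insert (i + 1) L, if j = i + 1 then c else 0) = c := by simp
  have hn : (∑ j ∈ insert (i + 1) L, if j = i + 1 then n else m j) = n + ∑ l ∈ L, m l := by
    rw [Finset.sum_insert hiL, if_pos rfl, Finset.sum_congr rfl fun l hl => if_neg (hLne l hl)]
  rw [hnext, hcr, hc, hn, add_comm 1 c] at hrun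
  refine ⟨_, DupRun.of_hits hTi ha hrun, fun h => ?_⟩
  have h1 : n = 0 := by omega
  have h2 : ∑ l ∈ L, m l = 0 := by omega
  refine ⟨h1, fun l hl hal => hm0 l hl (Finset.sum_eq_zero_iff.1 h2 l ?_)⟩
  simp only [hL, Finset.mem_filter, Finset.mem_Icc] at hl ⊢
  exact ⟨by omega, hal⟩

/-- A run that starts on one of the first `s` arborescences either delivers the packet along one
of them, or the packet hits a failed arc on each of the following ones. -/
theorem exists_run_first (hs : 1 ≤ s) (hT : IsDupFamily G d s T) (F : Finset β) (k : ℕ) :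
    ∀ i, 1 ≤ i → i + k = s → ∀ v ∈ V(G), ∃ c n, DupRun d s T F v i c n ∧
      ((i + c ≤ s ∧ 1 ≤ n ∧ ∀ j ∈ Finset.Ico i (i + c), ∃ a ∈ T j, a.edge ∈ F) ∨
        (c = k + (s - 1) ∧ ∃ a : ℕ → Arc α β,
          (∀ j ∈ Finset.Icc i s, a j ∈ T j ∧ (a j).edge ∈ F) ∧
          (n = 0 → ∀ l ∈ Finset.Icc (s + 1) (2 * s), (∃ b, Hits (T l) F (a s).tail b) ∧
            ∀ j ∈ Finset.Icc i s, (a j).reverse ∈ T l → ∃ b, Hits (T l) F (a j).tail b))) := by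
  induction k with
  | zero =>
    intro i hi his v hv
    obtain rfl : i = s := by omega
    have hTi := hT.arborescence i (Finset.mem_Icc.2 (by omega))
    rcases hTi.reaches_or_hits F hv with h | ⟨a, h⟩
    · refine ⟨0, 1, DupRun.of_reaches hTi h, Or.inl ⟨by omega, le_rfl, by simp⟩⟩
    · obtain ⟨n, hn, hn0⟩ := exists_run_of_hits_middle hs hT h
      refine ⟨_, n, hn, Or.inr ⟨by omega, fun _ => a, ?_, ?_⟩⟩
      · intro j hj
        obtain rfl : j = i := by rw [Finset.mem_Icc] at hj; omega
        exact h.mem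
      · exact fun h0 l hl => ⟨hn0 h0 l hl, fun _ _ _ => hn0 h0 l hl⟩
  | succ k ih =>
    intro i hi his v hv
    have hTi := hT.arborescence i (Finset.mem_Icc.2 (by omega))
    rcases hTi.reaches_or_hits F hv with h | ⟨a, h⟩
    · exact ⟨0, 1, DupRun.of_reaches hTi h, Or.inl ⟨by omega, le_rfl, by simp⟩⟩
    · obtain ⟨c, n, hrun, hcase⟩ := ih (i + 1) (by omega) (by omega) a.tail
        (hTi.link h.mem.1).left_mem
      obtain ⟨n', hrun', hn'⟩ := exists_run_of_hits_first hT hi (by omega) h hrun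
      refine ⟨_, n', hrun', ?_⟩
      rcases hcase with ⟨h1, h2, hb⟩ | ⟨h1, b, hb, hb0⟩
      · refine Or.inl ⟨by omega, ?_, ?_⟩
        · by_contra hh
          have := (hn' (by omega)).1
          omega
        · intro j hj
          rw [Finset.mem_Ico] at hj
          by_cases hji : j = i
          · subst hji; exact ⟨a, h.mem⟩
          · exact hb j (Finset.mem_Ico.2 (by omega))
      · refine Or.inr ⟨by omega, fun j => if j = i then a else b j, ?_, ?_⟩
        · intro j hj
          rw [Finset.mem_Icc] at hj
          by_cases hji : j = i
          · subst hji; simpa using h.mem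
          · simpa [hji] using hb j (Finset.mem_Icc.2 (by omega))
        · intro h0 l hl
          obtain ⟨h3, h4⟩ := hn' h0
          obtain ⟨h5, h6⟩ := hb0 h3 l hl
          have hsi : s ≠ i := by omega
          refine ⟨by simpa [hsi] using h5, fun j hj => ?_⟩
          rw [Finset.mem_Icc] at hj
          by_cases hji : j = i
          · subst hji; simpa using h4 l hl
          · simpa [hji] using h6 j (Finset.mem_Icc.2 (by omega))

/-- Arcs of different arborescences among the first `s` use different edges. -/
theorem IsDupFamily.edge_ne_first (hT : IsDupFamily G d s T) {i j : ℕ} (hi : i ∈ Finset.Icc 1 s)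
    (hj : j ∈ Finset.Icc 1 s) (hij : i ≠ j) {a b : Arc α β} (ha : a ∈ T i) (hb : b ∈ T j) :
    a.edge ≠ b.edge := by
  intro h
  rw [Finset.mem_Icc] at hi hj
  have hi' : i ∈ Finset.Icc 1 (2 * s) := Finset.mem_Icc.2 (by omega)
  have hj' : j ∈ Finset.Icc 1 (2 * s) := Finset.mem_Icc.2 (by omega)
  rcases eq_or_eq_reverse ((hT.arborescence i hi').link ha) ((hT.arborescence j hj').link hb) h
    with rfl | rfl
  · exact Set.disjoint_left.1 (hT.arcDisjoint i hi' j hj' hij) ha hb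
  · exact hT.notShare_first i (Finset.mem_Icc.2 hi) j (Finset.mem_Icc.2 hj) hij a ha hb

/-- Arcs of different arborescences among the last `s` use different edges. -/
theorem IsDupFamily.edge_ne_last (hT : IsDupFamily G d s T) {i j : ℕ}
    (hi : i ∈ Finset.Icc (s + 1) (2 * s)) (hj : j ∈ Finset.Icc (s + 1) (2 * s)) (hij : i ≠ j)
    {a b : Arc α β} (ha : a ∈ T i) (hb : b ∈ T j) : a.edge ≠ b.edge := by
  intro h
  rw [Finset.mem_Icc] at hi hj
  have hi' : i ∈ Finset.Icc 1 (2 * s) := Finset.mem_Icc.2 (by omega)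
  have hj' : j ∈ Finset.Icc 1 (2 * s) := Finset.mem_Icc.2 (by omega)
  rcases eq_or_eq_reverse ((hT.arborescence i hi').link ha) ((hT.arborescence j hj').link hb) h
    with rfl | rfl
  · exact Set.disjoint_left.1 (hT.arcDisjoint i hi' j hj' hij) ha hb
  · exact hT.notShare_last i (Finset.mem_Icc.2 hi) j (Finset.mem_Icc.2 hj) hij a ha hb

theorem IsDupFamily.card_le_of_failed (hT : IsDupFamily G d s T) {S : Finset ℕ}
    (hS : S ⊆ Finset.Icc 1 s) (ha : ∀ j ∈ S, ∃ a ∈ T j, a.edge ∈ F) :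
    S.card ≤ F.card := by
  rcases S.eq_empty_or_nonempty with rfl | ⟨k, hk⟩
  · simp
  have : Nonempty (Arc α β) := ⟨(ha k hk).choose⟩
  choose! a ha using ha
  refine Finset.card_le_card_of_injOn (fun j => (a j).edge) (fun j hj => (ha j hj).2) ?_
  intro i hi j hj h
  by_contra hij
  exact hT.edge_ne_first (hS hi) (hS hj) hij (ha i hi).1 (ha j hj).1 h

/-- If no packet is delivered, then at least `2 * s` edges have failed. -/
theorem IsDupFamily.two_mul_le_card (hs : 1 ≤ s) (hT : IsDupFamily G d s T) {a : ℕ → Arc α β}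
    (ha : ∀ j ∈ Finset.Icc 1 s, a j ∈ T j ∧ (a j).edge ∈ F)
    (hn : ∀ l ∈ Finset.Icc (s + 1) (2 * s), (∃ b, Hits (T l) F (a s).tail b) ∧
      ∀ j ∈ Finset.Icc 1 s, (a j).reverse ∈ T l → ∃ b, Hits (T l) F (a j).tail b) :
    2 * s ≤ F.card := by
  have hT' : ∀ {j}, j ∈ Finset.Icc 1 s → IsArborescence G d (T j) := fun {j} hj => by
    rw [Finset.mem_Icc] at hj
    exact hT.arborescence j (Finset.mem_Icc.2 (by omega))
  have hT'' : ∀ {j}, j ∈ Finset.Icc (s + 1) (2 * s) → IsArborescence G d (T j) := fun {j} hj => by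
    rw [Finset.mem_Icc] at hj
    exact hT.arborescence j (Finset.mem_Icc.2 (by omega))
  have hss : s ∈ Finset.Icc 1 s := Finset.mem_Icc.2 (by omega)
  -- The excluded arcs are those on the edges of the `a j`. By arc-disjointness such an arc of `T l`
  -- is the reverse of some `a j`, and its head is where the copy bounced off `a j` started.
  have hlast : ∀ l ∈ Finset.Icc (s + 1) (2 * s), ∃ b ∈ T l, b.edge ∈ F ∧
      b ∉ {b | ∃ j ∈ Finset.Icc 1 s, (a j).edge = b.edge} := by
    intro l hl
    refine (hT'' hl).exists_failed_notMem ?_ ((hT' hss).link (ha s hss).1).left_mem (hn l hl).1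
    rintro b hb ⟨j, hj, hjb⟩
    rcases eq_or_eq_reverse ((hT' hj).link (ha j hj).1) ((hT'' hl).link hb) hjb with rfl | rfl
    · rw [Finset.mem_Icc] at hj hl
      exact (Set.disjoint_left.1 (hT.arcDisjoint j (Finset.mem_Icc.2 (by omega)) l
        (Finset.mem_Icc.2 (by omega)) (by omega)) (ha j (Finset.mem_Icc.2 hj)).1 hb).elim
    · exact (hn l hl).2 j hj hb
  have : Nonempty (Arc α β) := ⟨a s⟩
  choose! b hbT hbF hbne using hlast
  have hcase : ∀ j ∈ Finset.Icc 1 (2 * s), (j ≤ s ∧ j ∈ Finset.Icc 1 s) ∨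
      (¬ j ≤ s ∧ j ∈ Finset.Icc (s + 1) (2 * s)) := by
    intro j hj
    simp only [Finset.mem_Icc] at hj ⊢
    omega
  have hcard : (Finset.Icc 1 (2 * s)).card = 2 * s := by simp
  rw [← hcard]
  refine Finset.card_le_card_of_injOn (fun j => if j ≤ s then (a j).edge else (b j).edge) ?_ ?_
  · intro j hj
    rcases hcase j hj with ⟨h1, h2⟩ | ⟨h1, h2⟩
    · simpa [h1] using (ha j h2).2
    · simpa [h1] using hbF j h2
  · intro i hi j hj h
    by_contra hij
    rcases hcase i hi with ⟨h1, h2⟩ | ⟨h1, h2⟩ <;> rcases hcase j hj with ⟨h3, h4⟩ | ⟨h3, h4⟩ <;>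
      simp only [h1, h3, if_true, if_false] at h
    · exact hT.edge_ne_first h2 h4 hij (ha i h2).1 (ha j h4).1 h
    · exact hbne j h4 ⟨i, h2, h⟩
    · exact hbne i h2 ⟨j, h4, h.symm⟩
    · exact hT.edge_ne_last h2 h4 hij (hbT i h2) (hbT j h4) h

theorem IsDupFamily.exists_run (hs : 1 ≤ s) (hT : IsDupFamily G d s T) (F : Finset β) {v : α}
    (hv : v ∈ V(G)) : ∃ c n : ℕ, DupRun d s T F v 1 c n ∧ (F.card ≤ 2 * s - 1 → 1 ≤ n) ∧
      c ≤ dupBound s F.card := by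
  obtain ⟨c, n, hrun, hcase⟩ := exists_run_first hs hT F (s - 1) 1 le_rfl (by omega) v hv
  refine ⟨c, n, hrun, ?_⟩
  unfold dupBound
  -- On early delivery, `c` is at most `F.card` and at most `s - 1`. Otherwise all of the first `s`
  -- arborescences have failed, so `s ≤ F.card` and `c` is twice `s - 1`.
  rcases hcase with ⟨h1, h2, ha⟩ | ⟨h1, a, ha, hn⟩
  · have := hT.card_le_of_failed (fun j hj => by
      rw [Finset.mem_Ico] at hj
      exact Finset.mem_Icc.2 (by omega)) ha
    rw [Nat.card_Ico] at this
    refine ⟨fun _ => h2, ?_⟩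
    split_ifs <;> omega
  · have := hT.card_le_of_failed subset_rfl fun j hj => ⟨a j, ha j hj⟩
    rw [Nat.card_Icc] at this
    refine ⟨fun hF => ?_, ?_⟩
    · by_contra h0
      have := hT.two_mul_le_card hs ha (hn (by omega))
      omega
    · rw [if_neg (by omega)]
      omega

end Runs

/-! ### Worst-case failures -/

section Tightness

variable {α β : Type*} {G : Graph α β} {d : α} {s : ℕ} {T : ℕ → Set (Arc α β)} {F : Finset β}

/-- The packet stays at `v` while it moves through the failed arborescences, and each reroute costs
one copy. -/
theorem exists_run_of_hits_here (hT : IsDupFamily G d s T) {v : α} {m : ℕ}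
    (hm : m ≤ s) {c n : ℕ} (hrun : DupRun d s T F v m c n) (k : ℕ) :
    ∀ i, 1 ≤ i → i + k = m → (∀ j, i ≤ j → j < m → ∃ a ∈ T j, a.tail = v ∧ a.edge ∈ F) →
      ∃ n, DupRun d s T F v i (c + k) n := by
  induction k with
  | zero =>
    rintro i hi rfl -
    exact ⟨n, hrun⟩
  | succ k ih =>
    intro i hi him ha
    obtain ⟨n', hn'⟩ := ih (i + 1) (by omega) (by omega) fun j h1 h2 => ha j (by omega) h2
    obtain ⟨a, haT, rfl, haF⟩ := ha i le_rfl (by omega)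
    obtain ⟨n'', hn'', -⟩ := exists_run_of_hits_first hT hi (by omega) (Hits.here haT haF) hn'
    exact ⟨n'', hn''⟩

theorem IsDupFamily.exists_worst_case (hs : 1 ≤ s) (hT : IsDupFamily G d s T) (hE : E(G).Finite)
    (hV : V(G).Nontrivial) {f : ℕ} (hf : f ≤ E(G).ncard) : ∃ F : Finset β, (F : Set β) ⊆ E(G) ∧
      F.card = f ∧ ∃ v ∈ V(G), ∃ n : ℕ, DupRun d s T F v 1 (dupBound s f) n := by
  classical
  obtain ⟨v, hv, hvd⟩ := hV.exists_ne d
  have hT' : ∀ {j}, j ∈ Finset.Icc 1 s → IsArborescence G d (T j) := fun {j} hj => by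
    rw [Finset.mem_Icc] at hj
    exact hT.arborescence j (Finset.mem_Icc.2 (by omega))
  have : Nonempty (Arc α β) :=
    ⟨((hT' (Finset.mem_Icc.2 ⟨le_rfl, hs⟩)).existsUnique_out v hv hvd).choose⟩
  choose! a ha using fun j (hj : j ∈ Finset.Icc 1 s) => ((hT' hj).existsUnique_out v hv hvd).exists
  have hsub : ∀ m ≤ s, Finset.Icc 1 m ⊆ Finset.Icc 1 s := fun m hm =>
    Finset.Icc_subset_Icc le_rfl hm
  have hF₀card : ∀ m ≤ s, ((Finset.Icc 1 m).image fun j => (a j).edge).card = m := by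
    intro m hm
    rw [Finset.card_image_of_injOn, Nat.card_Icc, Nat.add_sub_cancel]
    intro i hi j hj h
    by_contra hij
    exact hT.edge_ne_first (hsub m hm hi) (hsub m hm hj) hij (ha i (hsub m hm hi)).1
      (ha j (hsub m hm hj)).1 h
  have hF₀E : ∀ m ≤ s, ((Finset.Icc 1 m).image fun j => (a j).edge) ⊆ hE.toFinset := by
    intro m hm e he
    obtain ⟨j, hj, rfl⟩ := Finset.mem_image.1 he
    rw [hE.mem_toFinset]
    exact ((hT' (hsub m hm hj)).link (ha j (hsub m hm hj)).1).edge_mem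
  have hF₀mem : ∀ m, ∀ j, 1 ≤ j → j ≤ m → (a j).edge ∈ (Finset.Icc 1 m).image fun j => (a j).edge :=
    fun m j h1 h2 => Finset.mem_image.2 ⟨j, Finset.mem_Icc.2 ⟨h1, h2⟩, rfl⟩
  by_cases hfs : f < s
  -- Exactly the out-arcs of `T 1, …, T f` at `v` fail. They share no edge with `T (f + 1)`, which
  -- therefore delivers.
  · refine ⟨_, fun e he => hE.mem_toFinset.1 (hF₀E f hfs.le he), hF₀card f hfs.le, v, hv, ?_⟩
    have hf1 : f + 1 ∈ Finset.Icc 1 s := Finset.mem_Icc.2 (by omega)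
    have hrun : DupRun d s T ((Finset.Icc 1 f).image fun j => (a j).edge) v (f + 1) 0 1 := by
      refine DupRun.of_reaches (hT' hf1) (((hT' hf1).reaches_or_hits _ hv).resolve_right ?_)
      rintro ⟨b, hb⟩
      obtain ⟨hbT, hbF⟩ := hb.mem
      obtain ⟨j, hj, hjb⟩ := Finset.mem_image.1 hbF
      refine hT.edge_ne_first (hsub f hfs.le hj) hf1 ?_ (ha j (hsub f hfs.le hj)).1 hbT hjb
      rw [Finset.mem_Icc] at hj
      omega
    have := exists_run_of_hits_here hT (by omega) hrun f 1 le_rfl (by omega) fun j h1 h2 =>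
      ⟨a j, (ha j (Finset.mem_Icc.2 (by omega))).1, (ha j (Finset.mem_Icc.2 (by omega))).2,
        hF₀mem f j h1 (by omega)⟩
    have hb : dupBound s f = 0 + f := by
      unfold dupBound
      rw [if_pos hfs, zero_add]
    rwa [hb]
  -- The out-arcs of `T 1, …, T s` at `v` already force all copies, so the other failures may be
  -- arbitrary.
  · obtain ⟨F, hF₀, hFE, hFc⟩ := Finset.exists_subsuperset_card_eq (hF₀E s le_rfl)
      (by rw [hF₀card s le_rfl]; omega : _ ≤ f)
      (by rwa [← Set.ncard_eq_toFinset_card _ hE])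
    refine ⟨F, fun e he => hE.mem_toFinset.1 (hFE he), hFc, v, hv, ?_⟩
    have hss : s ∈ Finset.Icc 1 s := Finset.mem_Icc.2 (by omega)
    obtain ⟨n, hrun, -⟩ := exists_run_of_hits_middle (F := F) hs hT (v := v) (a := a s) (by
      have := Hits.here (ha s hss).1 (hF₀ (hF₀mem s s hs le_rfl))
      rwa [(ha s hss).2] at this)
    have := exists_run_of_hits_here hT le_rfl hrun (s - 1) 1 le_rfl (by omega) fun j h1 h2 =>
      ⟨a j, (ha j (Finset.mem_Icc.2 (by omega))).1, (ha j (Finset.mem_Icc.2 (by omega))).2,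
        hF₀ (hF₀mem s j h1 (by omega))⟩
    have hb : dupBound s f = s - 1 + (s - 1) := by
      unfold dupBound
      rw [if_neg hfs]
      omega
    rwa [hb]

end Tightness

/-! ### From runs to routing functions -/

section Resilience

variable {α β : Type*} {G : Graph α β} {d : α} {s : ℕ} {T : ℕ → Set (Arc α β)} {F : Finset β}

/-- The routing functions deliver the packets that the scheme delivers. -/
theorem DupRun.exists_visits (hT : IsDupFamily G d s T) {o v : α} {j c n : ℕ}
    (h : DupRun d s T F v j c n) : j ∈ Finset.Icc 1 (2 * s) → 1 ≤ n →
      ∀ inc, Visits G F d (dupRouting s T) o v inc →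
        (∃ i ∈ dupCurrent s T v inc, DupReroutes s T v (activeEdges G F v) i j) →
        ∃ inc, Visits G F d (dupRouting s T) o d inc := by
  induction h with
  | deliver i => exact fun _ _ inc hv _ => ⟨inc, hv⟩
  | @forward j c n a h1 h2 h3 _ ih =>
    rintro hj hn inc hv ⟨i, hi, hij⟩
    have hl := (hT.arborescence j hj).link h2
    -- After a hop, the incoming edge reveals the index `j` again, so the chain of reroutes restarts
    -- at the new vertex.
    refine ih hj hn (some a.edge) (Visits.hop hv h1 ?_ h3 hl)
      ⟨j, ⟨hj, a, h2, rfl, rfl⟩, DupReroutes.refl⟩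
    exact ⟨⟨hl.inc_left, h3⟩, i, hi, j, hij, a, h2, rfl, rfl⟩
  | @reroute j a c n h1 h2 h3 _ ih =>
    rintro hj hn inc hv ⟨i, hi, hij⟩
    -- Some branch of the reroute delivers a packet. Following it keeps the vertex and extends the
    -- chain of reroutes by one.
    obtain ⟨l, hl, hnl⟩ := Finset.exists_ne_zero_of_sum_ne_zero
      (by omega : ∑ j ∈ dupNext s T j a, n j ≠ 0)
    exact ih l hl (dupNext_subset hj hl) (Nat.one_le_iff_ne_zero.2 hnl) inc hv
      ⟨i, hi, hij.step h2 rfl (fun hh => hh.2 h3) hl⟩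

theorem IsDupFamily.isResilient (hs : 1 ≤ s) (hT : IsDupFamily G d s T) :
    IsResilient G d (dupRouting s T) (2 * s - 1) := by
  intro F _ hFc v hv _
  obtain ⟨c, n, hrun, hn, -⟩ := hT.exists_run hs F hv
  exact hrun.exists_visits hT (Finset.mem_Icc.2 (by omega)) (hn hFc) none Visits.origin
    ⟨1, rfl, DupReroutes.refl⟩

end Resilience

end FailoverRouting

theorem mainTheorem6 {α : Type*} {β : Type*} (G : Graph α β)
    (hV : V(G).Finite) (hE : E(G).Finite) (d : α) (hd : d ∈ V(G))
    (s : ℕ) (hs : 1 ≤ s) (hG : FailoverRouting.IsEdgeConnected G (2 * s)) :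
    (∃ T : ℕ → Set (FailoverRouting.Arc α β), FailoverRouting.IsDupFamily G d s T) ∧
    ∀ T : ℕ → Set (FailoverRouting.Arc α β), FailoverRouting.IsDupFamily G d s T →
      FailoverRouting.IsResilient G d (FailoverRouting.dupRouting s T) (2 * s - 1) ∧
      (∀ F : Finset β, (F : Set β) ⊆ E(G) → ∀ v ∈ V(G), ∃ c n : ℕ,
        FailoverRouting.DupRun d s T F v 1 c n ∧
        (∀ c' n' : ℕ, FailoverRouting.DupRun d s T F v 1 c' n' → c' = c ∧ n' = n) ∧
        (F.card ≤ 2 * s - 1 → 1 ≤ n) ∧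
        c ≤ FailoverRouting.dupBound s F.card) ∧
      (V(G).Nontrivial → ∀ f : ℕ, f ≤ E(G).ncard → ∃ F : Finset β, (F : Set β) ⊆ E(G) ∧
        F.card = f ∧ ∃ v ∈ V(G), ∃ n : ℕ,
        FailoverRouting.DupRun d s T F v 1 (FailoverRouting.dupBound s f) n) := by
  refine ⟨FailoverRouting.exists_isDupFamily hV hE hd hs hG, fun T hT => ⟨hT.isResilient hs, ?_,
    fun hnt f hf => hT.exists_worst_case hs hE hnt hf⟩⟩
  intro F _ v hv
  obtain ⟨c, n, hrun, hn, hc⟩ := hT.exists_run hs F hv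
  exact ⟨c, n, hrun, hrun.unique hT (Finset.mem_Icc.2 (by omega)), hn, hc⟩
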